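/- Let $K$ be a field, let $H\subseteq\mathbb{N}_0$ be a numerical semigroup (a submonoid of $\mathbb{N}_0$ with finite complement), and let $R=K[|H|]=K[|t^h : h\in H|]\subseteq K[|t|]$ be its semigroup ring, a one-dimensional Cohen-Macaulay local ring with maximal ideal $\mathfrak m$ and residue field $k$. Let $\overline R$ be the integral closure of $R$ in its total ring of fractions $\mathrm Q(R)$. Recall that the type of $R$ is $\mathrm r(R)=\dim_k\mathrm{Ext}^1_R(k,R)$; that $R$ has minimal multiplicity if its multiplicity $\mathrm e(R)=\lim_{n\to\infty}\ell_R(R/\mathfrak m^n)/n$ equals its embedding dimension $v(R)=\mu_R(\mathfrak m)$; and that $R$ is far-flung Gorenstein if $\overline R$ is a finitely generated $R$-module, $R$ has a canonical module $C$ with $R\subseteq C\subseteq\overline R$, and the trace ideal $\mathrm{tr}_R(C)=\sum_{f\in\mathrm{Hom}_R(C,R)}f(C)$ equals the conductor $R:\overline R=\{\alpha\in \mathrm Q(R) : \alpha\overline R\subseteq R\}$. Then $R$ is far-flung Gorenstein, of type $3$ and not of minimal multiplicity if and only if, for some integer $m\ge 1$, $H$ is one of $$\langle 5,5m+4,10m+6,10m+7\rangle,\quad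 \langle 5,5m+1,10m+3,10m+4\rangle,\quad \langle 5,5m+2,10m+1,10m+3\rangle,\quad \langle 5,5m+3,10m+4,10m+7\rangle .$$ In particular, if $R$ is of type $3$ and not of minimal multiplicity, then $R$ is far-flung Gorenstein if and only if $H$ is one of these semigroups for some $m\ge1$. -/

import Mathlib

open CategoryTheory

/-- The numerical semigroup ring `K[|H|] = K[|t^h : h ∈ H|]`: the power series over `K` whose
exponents all lie in `H`. -/
def semigroupRing (K : Type*) [Field K] (H : AddSubmonoid ℕ) : Subalgebra K (PowerSeries K) where
  carrier := {f | ∀ n, PowerSeries.coeff n f ≠ 0 → n ∈ H}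
  mul_mem' := by
    intro f g hf hg n hn
    rw [PowerSeries.coeff_mul] at hn
    obtain ⟨p, hp, hne⟩ := Finset.exists_ne_zero_of_sum_ne_zero hn
    rw [← Finset.HasAntidiagonal.mem_antidiagonal.mp hp]
    exact H.add_mem (hf _ (left_ne_zero_of_mul hne)) (hg _ (right_ne_zero_of_mul hne))
  add_mem' := by
    intro f g hf hg n hn
    by_cases h : PowerSeries.coeff n f = 0
    · refine hg n fun h' => hn ?_
      rw [map_add, h, h', add_zero]
    · exact hf n h
  algebraMap_mem' := by
    intro c n hn
    rw [PowerSeries.algebraMap_apply, PowerSeries.coeff_C] at hn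
    split_ifs at hn with h
    · rw [h]
      exact H.zero_mem
    · exact absurd rfl hn

theorem semigroupRing_isUnit (K : Type*) [Field K] (H : AddSubmonoid ℕ) (f : semigroupRing K H)
    (hf : PowerSeries.coeff 0 (f : PowerSeries K) ≠ 0) : IsUnit f := by
  have hu : (f : PowerSeries K) * (f : PowerSeries K)⁻¹ = 1 :=
    PowerSeries.mul_inv_cancel _ (by simpa using hf)
  have hg : (f : PowerSeries K)⁻¹ ∈ semigroupRing K H := by
    intro n
    induction n using Nat.strong_induction_on with
    | _ n ih =>
      intro hn
      by_contra hnH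
      have h0 : n ≠ 0 := fun h => hnH (h ▸ H.zero_mem)
      have hc : PowerSeries.coeff n ((f : PowerSeries K) * (f : PowerSeries K)⁻¹) = 0 := by
        rw [hu, PowerSeries.coeff_one, if_neg h0]
      rw [PowerSeries.coeff_mul, Finset.sum_eq_single (0, n)] at hc
      · exact mul_ne_zero hf hn hc
      · rintro ⟨i, j⟩ hij hne
        by_contra hprod
        have hsum : i + j = n := Finset.HasAntidiagonal.mem_antidiagonal.mp hij
        have hi : i ≠ 0 := by
          rintro rfl
          exact hne (by simpa using hsum)
        have hiH : i ∈ H := f.2 i (left_ne_zero_of_mul hprod)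
        have hjH : j ∈ H := ih j (by omega) (right_ne_zero_of_mul hprod)
        exact hnH (hsum ▸ H.add_mem hiH hjH)
      · intro h
        exact absurd (Finset.HasAntidiagonal.mem_antidiagonal.mpr (zero_add n)) h
  exact IsUnit.of_mul_eq_one ⟨_, hg⟩ (Subtype.ext hu)

instance semigroupRing_isLocalRing (K : Type*) [Field K] (H : AddSubmonoid ℕ) :
    IsLocalRing (semigroupRing K H) := by
  refine IsLocalRing.of_isUnit_or_isUnit_one_sub_self fun f => ?_
  by_cases hf : PowerSeries.coeff 0 (f : PowerSeries K) = 0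
  · refine Or.inr (semigroupRing_isUnit K H _ ?_)
    have h : ((1 - f : semigroupRing K H) : PowerSeries K) = 1 - (f : PowerSeries K) := rfl
    rw [h, map_sub, hf]
    simp
  · exact Or.inl (semigroupRing_isUnit K H f hf)

section LocalRing

universe u

variable (R : Type u) [CommRing R] [IsLocalRing R]

/-- The `R`-module `Ext^i_R(k, M)`, where `k` is the residue field of the local ring `R`. -/
abbrev ResidueExt (M : Type u) [AddCommGroup M] [Module R M] (i : ℕ) : Type u :=
  Abelian.Ext.{u} (ModuleCat.of R (IsLocalRing.ResidueField R)) (ModuleCat.of R M) i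

/-- `M` is a canonical module of the one-dimensional Cohen-Macaulay local ring `R`: it is finitely
generated, `Ext^1_R(k, M)` is isomorphic to `k` and `Ext^i_R(k, M) = 0` for `i ≠ 1`.
(As `Ext^i_R(k, M)` is a `k`-vector space, its length over `R` is its dimension over `k`.) -/
def IsCanonicalModule (M : Type u) [AddCommGroup M] [Module R M] : Prop :=
  Module.Finite R M ∧
    ∀ i : ℕ, Module.length R (ResidueExt R M i) = if i = 1 then 1 else 0

/-- The Cohen-Macaulay type `r(R) = dim_k Ext^1_R(k, R)` of a one-dimensional Cohen-Macaulay
local ring `R`. -/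
noncomputable def cohenMacaulayType : ℕ∞ := Module.length R (ResidueExt R R 1)

/-- `e` is the (Hilbert-Samuel) multiplicity of the one-dimensional Noetherian local ring `R`:
the limit of `length (R / 𝔪 ^ n) / n`. -/
def HasMultiplicity (e : ℕ) : Prop :=
  Filter.Tendsto
    (fun n : ℕ => ((Module.length R (R ⧸ IsLocalRing.maximalIdeal R ^ n)).toNat : ℝ) / (n : ℝ))
    Filter.atTop (nhds (e : ℝ))

/-- The embedding dimension `v(R)`: the minimal number of generators of the maximal ideal. -/
noncomputable def embeddingDim : ℕ := (IsLocalRing.maximalIdeal R).spanFinrank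

/-- A one-dimensional Cohen-Macaulay local ring has minimal multiplicity if `e(R) = v(R)`. -/
def HasMinimalMultiplicity : Prop := HasMultiplicity R (embeddingDim R)

end LocalRing

section Trace

universe u

variable (R : Type u) [CommRing R]

/-- The trace ideal `tr_R(M)`: the sum of the images of all `R`-linear maps `M → R`. -/
def traceIdeal (M : Type u) [AddCommGroup M] [Module R M] : Ideal R :=
  ⨆ f : M →ₗ[R] R, LinearMap.range f

/-- The integral closure of `R` in its total ring of fractions `Q(R)`, as an `R`-submodule
of `Q(R)`. -/
noncomputable def normalization : Submodule R (FractionRing R) :=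
  Subalgebra.toSubmodule (integralClosure R (FractionRing R))

/-- The one-dimensional Cohen-Macaulay local ring `R` is far-flung Gorenstein: its integral closure
`R̄` in `Q(R)` is a finitely generated `R`-module, there is an `R`-submodule `C` of `Q(R)` with
`R ⊆ C ⊆ R̄` which is a canonical module of `R`, and `tr_R(C) = R : R̄` inside `Q(R)`. -/
def IsFarFlungGorenstein [IsLocalRing R] : Prop :=
  (normalization R).FG ∧
    ∃ C : Submodule R (FractionRing R), 1 ≤ C ∧ C ≤ normalization R ∧ IsCanonicalModule R C ∧
      Submodule.map (Algebra.linearMap R (FractionRing R)) (traceIdeal R C) =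
        1 / normalization R

end Trace

/-! ### Ext groups of the residue field from a short injective resolution. -/

section ResidueExt

universe u

variable {R : Type u} [CommRing R]

variable {M L : Type u} [AddCommGroup M] [Module R M] [AddCommGroup L] [Module R L]

/-! Inside `K((t))`, the fraction field of `R`, every invariant in the statement is read off sets of
exponents. Modules of Laurent series supported on an `H`-stable set are the basic objects, and
lengths of their quotients count exponents (`length_of_surjective_of_ker`). Hence the multiplicity
is the least nonzero `e ∈ H`, the embedding dimension is the number of indecomposable elements, and,
since `K((t))` is an injective `R`-module, the type is the number of pseudo-Frobenius numbers.

Let `F` be the Frobenius number and `C` the module with exponent set `{n | F - n ∉ H}`. It is the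
orthogonal of `R` for the pairing `(f, g) ↦ coeff F (f * g)`. This duality makes `K((t)) / C`
injective (`baer_quotient_canonical`), so `C` is canonical, and it shows that any canonical
fractional ideal containing `R` is a multiple `u⁻¹ C` (`exists_mul_mem_canonical_iff`). A monomial
`t ^ k` maps `C` into `R` exactly when `F - k` is not a sum of two exponents of `C`. The conductor
consists of the series with exponents above `F`, so `R` is far-flung Gorenstein iff every `n ≥ 0` is
a sum of two exponents of `C` (`isFarFlungGorenstein_iff`).

In type 3 write the pseudo-Frobenius numbers as `F, F - a, F - b` with `0 < a < b`. Then `0, a, b,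
2a, a + b, 2b` must cover `0, ..., e - 1`, while the three numbers lie in distinct nonzero classes
mod `e`. This forces `a = 1`, `b ∈ {2, 3}` and `e ∈ {4, 5}`. For `e = 4` the multiplicity is
minimal. For `e = 5` exactly one nonzero class mod 5 contains no pseudo-Frobenius number; if `x` is
the least element of `H` in it, then `2x - 5` is pseudo-Frobenius, which determines `H` from `x` and
yields the four families with `m = x / 5`. -/

theorem shortExact_quotient_range (ι : M →ₗ[R] L) (hι : Function.Injective ι) :
    (ShortComplex.mk (ModuleCat.ofHom ι) (ModuleCat.ofHom (LinearMap.range ι).mkQ)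
      (by rw [← ModuleCat.ofHom_comp, LinearMap.range_mkQ_comp]; rfl)).ShortExact where
  exact := (ShortComplex.ShortExact.moduleCat_exact_iff_function_exact _).mpr
    (LinearMap.exact_map_mkQ_range ι)
  mono_f := (ModuleCat.mono_iff_injective _).mpr hι
  epi_g := (ModuleCat.epi_iff_surjective _).mpr (Submodule.mkQ_surjective _)

variable [IsLocalRing R]

/-- Homomorphisms from the residue field correspond to elements killed by the maximal ideal. -/
noncomputable def residueFieldHomEquiv (N : Type u) [AddCommGroup N] [Module R N] :
    (IsLocalRing.ResidueField R →ₗ[R] N) ≃ₗ[R]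
      Submodule.torsionBySet R N (IsLocalRing.maximalIdeal R : Set R) where
  toFun f := ⟨f 1, by
    rw [Submodule.mem_torsionBySet_iff]
    rintro ⟨a, ha⟩
    have h : a • (1 : IsLocalRing.ResidueField R) = 0 := by
      rw [Algebra.smul_def, mul_one, IsLocalRing.ResidueField.algebraMap_eq]
      exact (IsLocalRing.residue_eq_zero_iff a).mpr ha
    simp only
    rw [← map_smul, h, map_zero]⟩
  map_add' _ _ := rfl
  map_smul' _ _ := rfl
  invFun x := (Submodule.liftQ (IsLocalRing.maximalIdeal R) (LinearMap.toSpanSingleton R N x)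
    (fun a ha => by
      rw [LinearMap.mem_ker, LinearMap.toSpanSingleton_apply]
      exact (Submodule.mem_torsionBySet_iff _ _).mp x.2 ⟨a, ha⟩) :
        (R ⧸ IsLocalRing.maximalIdeal R) →ₗ[R] N)
  left_inv f := by
    refine LinearMap.ext fun y => ?_
    obtain ⟨a, rfl⟩ := Submodule.mkQ_surjective (IsLocalRing.maximalIdeal R) y
    refine (Submodule.liftQ_apply _ _ _).trans ?_
    rw [LinearMap.toSpanSingleton_apply]
    simp only
    rw [← map_smul]
    congr 1
    rw [Algebra.smul_def, mul_one]
    rfl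
  right_inv x := by
    refine Subtype.ext ?_
    refine (Submodule.liftQ_apply (IsLocalRing.maximalIdeal R)
      (LinearMap.toSpanSingleton R N x) 1).trans ?_
    rw [LinearMap.toSpanSingleton_apply, one_smul]

theorem length_residueExt_zero (hM : ∀ x : M, (∀ r ∈ IsLocalRing.maximalIdeal R, r • x = 0) → x = 0) :
    Module.length R (ResidueExt R M 0) = 0 := by
  rw [Module.length_eq_zero_iff]
  have e := (Abelian.Ext.linearEquiv₀ (R := R) (X := ModuleCat.of R (IsLocalRing.ResidueField R))
    (Y := ModuleCat.of R M)).trans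
    ((ModuleCat.homLinearEquiv (S := R)).trans (residueFieldHomEquiv M))
  refine e.toEquiv.subsingleton_congr.mpr ⟨fun x y => ?_⟩
  have h : ∀ z : Submodule.torsionBySet R M (IsLocalRing.maximalIdeal R : Set R), z = 0 := fun z =>
    Subtype.ext (hM z fun r hr => (Submodule.mem_torsionBySet_iff _ _).mp z.2 ⟨r, hr⟩)
  rw [h x, h y]

/-- In the long exact sequence of `0 → M → L → L/M → 0`, `Hom(k, L)` vanishes by `hL` and `Ext¹(k,
L)` by injectivity, so the connecting map `Hom(k, L/M) → Ext¹(k, M)` is bijective. -/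
theorem length_residueExt_one [Module.Injective R L] (ι : M →ₗ[R] L) (hι : Function.Injective ι)
    (hL : ∀ x : L, (∀ r ∈ IsLocalRing.maximalIdeal R, r • x = 0) → x = 0) :
    Module.length R (ResidueExt R M 1) = Module.length R
      (Submodule.torsionBySet R (L ⧸ LinearMap.range ι) (IsLocalRing.maximalIdeal R : Set R)) := by
  have hS := shortExact_quotient_range ι hι
  set X := ModuleCat.of R (IsLocalRing.ResidueField R) with hX
  have hinj : Injective (ModuleCat.of R L) := Module.injective_object_of_injective_module R L
  let δ : Abelian.Ext X (ModuleCat.of R (L ⧸ LinearMap.range ι)) 0 →ₗ[R]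
      Abelian.Ext X (ModuleCat.of R M) 1 :=
    (Abelian.Ext.bilinearCompOfLinear R _ _ _ 0 1 1 (zero_add 1)).flip hS.extClass
  have hδ : Function.Bijective δ := by
    constructor
    · rw [injective_iff_map_eq_zero]
      intro x hx
      obtain ⟨y, rfl⟩ := Abelian.Ext.covariant_sequence_exact₃ X hS x (zero_add 1) hx
      have hy : y = 0 := by
        have h0 := length_residueExt_zero (R := R) (M := L) hL
        rw [Module.length_eq_zero_iff] at h0
        exact Subsingleton.elim (α := ResidueExt R L 0) _ _
      rw [hy]
      apply Abelian.Ext.zero_comp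
    · intro x
      exact Abelian.Ext.covariant_sequence_exact₁ X hS x
        (Abelian.Ext.eq_zero_of_injective (I := ModuleCat.of R L) _) (zero_add 1)
  have e := (LinearEquiv.ofBijective δ hδ).symm.trans ((Abelian.Ext.linearEquiv₀ (R := R)).trans
    ((ModuleCat.homLinearEquiv (S := R)).trans (residueFieldHomEquiv (L ⧸ LinearMap.range ι))))
  exact e.length_eq

/-- `Ext^(i+2)(k, M)` sits between `Ext^(i+1)(k, L/M)` and `Ext^(i+2)(k, L)`, which both vanish. -/
theorem length_residueExt_add_two [Module.Injective R L] (ι : M →ₗ[R] L)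
    (hι : Function.Injective ι) [Module.Injective R (L ⧸ LinearMap.range ι)] (i : ℕ) :
    Module.length R (ResidueExt R M (i + 2)) = 0 := by
  rw [Module.length_eq_zero_iff]
  have hS := shortExact_quotient_range ι hι
  have hinj : Injective (ModuleCat.of R L) := Module.injective_object_of_injective_module R L
  have hinj' : Injective (ModuleCat.of R (L ⧸ LinearMap.range ι)) :=
    Module.injective_object_of_injective_module R _
  refine ⟨fun x y => ?_⟩
  have h : ∀ z : ResidueExt R M (i + 2), z = 0 := fun z => by
    obtain ⟨y, rfl⟩ := Abelian.Ext.covariant_sequence_exact₁ _ hS z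
        (Abelian.Ext.eq_zero_of_injective (I := ModuleCat.of R L) (n := i + 1) _)
        (n₀ := i + 1) rfl
    have hy : y = 0 :=
      Abelian.Ext.eq_zero_of_injective (I := ModuleCat.of R (L ⧸ LinearMap.range ι)) (n := i) y
    rw [hy]
    apply Abelian.Ext.zero_comp
  rw [h x, h y]

end ResidueExt

/-! ### Modules of Laurent series with prescribed exponents, and their lengths. -/

section MonomialModule

open IsLocalRing

universe u

/-- Since `ker φ ≤ ker c`, the quotient of `N` by `φ(ker c)` is `P / ker c ≅ Q`. This peels one
factor `Q` off `N` in the induction of `length_of_surjective_of_ker`. -/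
theorem length_eq_length_map_ker_add {R P N Q : Type*} [CommRing R] [AddCommGroup P] [Module R P]
    [AddCommGroup N] [Module R N] [AddCommGroup Q] [Module R Q] {φ : P →ₗ[R] N} {c : P →ₗ[R] Q}
    (hφ : Function.Surjective φ) (hc : Function.Surjective c)
    (h : LinearMap.ker φ ≤ LinearMap.ker c) :
    Module.length R N = Module.length R ((LinearMap.ker c).map φ) + Module.length R Q := by
  have hker : LinearMap.ker (((LinearMap.ker c).map φ).mkQ.comp φ) = LinearMap.ker c := by
    rw [LinearMap.ker_comp, Submodule.ker_mkQ, Submodule.comap_map_eq, sup_eq_left.mpr h]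
  have e : (N ⧸ (LinearMap.ker c).map φ) ≃ₗ[R] Q :=
    ((((LinearMap.ker c).map φ).mkQ.comp φ).quotKerEquivOfSurjective
      ((Submodule.mkQ_surjective _).comp hφ)).symm.trans
        ((Submodule.quotEquivOfEq _ _ hker).trans (c.quotKerEquivOfSurjective hc))
  rw [Module.length_eq_add_of_exact ((LinearMap.ker c).map φ).subtype
    ((LinearMap.ker c).map φ).mkQ (Submodule.injective_subtype _) (Submodule.mkQ_surjective _)
    (LinearMap.exact_subtype_mkQ _), e.length_eq]

variable {K : Type u} [Field K]

theorem exists_of_coeff_mul_ne_zero {f g : LaurentSeries K} {n : ℤ} (h : (f * g).coeff n ≠ 0) :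
    ∃ i j, i + j = n ∧ f.coeff i ≠ 0 ∧ g.coeff j ≠ 0 := by
  rw [HahnSeries.coeff_mul] at h
  obtain ⟨p, hp, hne⟩ := Finset.exists_ne_zero_of_sum_ne_zero h
  refine ⟨p.1, p.2, ?_, left_ne_zero_of_mul hne, right_ne_zero_of_mul hne⟩
  simpa using (Finset.mem_antidiagonal.mp hp).2.2

/-- The `R`-algebra structure of `K((t))` identifies `R` with the semigroup ring `K[|H|]`. -/
class IsSemigroupRing (K : Type u) [Field K] (H : AddSubmonoid ℕ) (R : Type u) [CommRing R]
    [Algebra R (LaurentSeries K)] : Prop where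
  algebraMap_injective : Function.Injective (algebraMap R (LaurentSeries K))
  mem_range_algebraMap_iff : ∀ f : LaurentSeries K, f ∈ (algebraMap R (LaurentSeries K)).range ↔
    ∀ n, f.coeff n ≠ 0 → ∃ h ∈ H, (h : ℤ) = n
  isUnit_of_coeff_zero_ne_zero : ∀ r : R, (algebraMap R (LaurentSeries K) r).coeff 0 ≠ 0 → IsUnit r

open IsSemigroupRing

variable (H : AddSubmonoid ℕ) {R : Type u} [CommRing R] [Algebra R (LaurentSeries K)]
  [IsSemigroupRing K H R]

theorem exists_algebraMap_eq {f : LaurentSeries K}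
    (hf : ∀ n, f.coeff n ≠ 0 → ∃ h ∈ H, (h : ℤ) = n) :
    ∃ r : R, algebraMap R (LaurentSeries K) r = f :=
  (mem_range_algebraMap_iff f).mpr hf

theorem exists_of_coeff_algebraMap_ne_zero {r : R} {n : ℤ}
    (h : (algebraMap R (LaurentSeries K) r).coeff n ≠ 0) : ∃ k ∈ H, (k : ℤ) = n :=
  (mem_range_algebraMap_iff (H := H) (algebraMap R (LaurentSeries K) r)).mp ⟨r, rfl⟩ n h

theorem exists_of_coeff_smul_ne_zero {r : R} {f : LaurentSeries K} {n : ℤ}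
    (h : (r • f).coeff n ≠ 0) :
    ∃ k : ℕ, k ∈ H ∧ (algebraMap R (LaurentSeries K) r).coeff k ≠ 0 ∧ f.coeff (n - k) ≠ 0 := by
  rw [Algebra.smul_def] at h
  obtain ⟨i, j, rfl, hi, hj⟩ := exists_of_coeff_mul_ne_zero h
  obtain ⟨k, hk, rfl⟩ := exists_of_coeff_algebraMap_ne_zero H hi
  exact ⟨k, hk, hi, by rwa [add_sub_cancel_left]⟩

/-- Only the constant term of `r` contributes: each other exponent `k` of `r` meets the coefficient
of `f` at `n - k`, which is zero. -/
theorem coeff_smul_eq (r : R) {f : LaurentSeries K} {n : ℤ}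
    (h : ∀ k ∈ H, k ≠ 0 → f.coeff (n - k) = 0) :
    (r • f).coeff n = (algebraMap R (LaurentSeries K) r).coeff 0 * f.coeff n := by
  set c := (algebraMap R (LaurentSeries K) r).coeff 0 with hc
  have h1 : (HahnSeries.single (0 : ℤ) c * f).coeff n = c * f.coeff n := by
    rw [HahnSeries.coeff_single_mul, sub_zero]
  rw [← h1, Algebra.smul_def, ← sub_eq_zero, ← HahnSeries.coeff_sub, ← sub_mul]
  by_contra hne
  obtain ⟨i, j, rfl, hi, hj⟩ := exists_of_coeff_mul_ne_zero hne
  rw [HahnSeries.coeff_sub, HahnSeries.coeff_single] at hi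
  split_ifs at hi with h0
  · rw [h0, hc, sub_self] at hi
    exact hi rfl
  · rw [sub_zero] at hi
    obtain ⟨k, hk, rfl⟩ := exists_of_coeff_algebraMap_ne_zero H hi
    refine hj ?_
    have := h k hk (fun h => h0 (by rw [h]; rfl))
    rwa [add_sub_cancel_left] at this

theorem mem_maximalIdeal_iff_coeff_zero (H : AddSubmonoid ℕ) [IsSemigroupRing K H R]
    [IsLocalRing R] {r : R} :
    r ∈ maximalIdeal R ↔ (algebraMap R (LaurentSeries K) r).coeff 0 = 0 := by
  rw [mem_maximalIdeal, mem_nonunits_iff]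
  refine ⟨fun h => by_contra fun h' => h (isUnit_of_coeff_zero_ne_zero H r h'), fun h hu => ?_⟩
  obtain ⟨s, hs⟩ := hu.exists_right_inv
  have h1 := coeff_smul_eq H r (f := algebraMap R (LaurentSeries K) s) (n := 0) fun k _ hk0 => by
    by_contra hne
    obtain ⟨l, -, hl⟩ := exists_of_coeff_algebraMap_ne_zero H hne
    omega
  rw [Algebra.smul_def, ← map_mul, hs, h, zero_mul, map_one, HahnSeries.coeff_one, if_pos rfl] at h1
  exact one_ne_zero h1

/-- The inclusion of the constants in a semigroup ring. -/
noncomputable def semigroupRingConst (K : Type u) [Field K] (H : AddSubmonoid ℕ) (R : Type u)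
    [CommRing R] [Algebra R (LaurentSeries K)] [IsSemigroupRing K H R] : K →+* R :=
  (RingEquiv.ofBijective (algebraMap R (LaurentSeries K)).rangeRestrict
    ⟨fun _ _ h => algebraMap_injective H (Subtype.ext_iff.mp h),
      RingHom.rangeRestrict_surjective _⟩).symm.toRingHom.comp
    ((HahnSeries.C : K →+* LaurentSeries K).codRestrict (algebraMap R (LaurentSeries K)).range
      fun c => (mem_range_algebraMap_iff (H := H) _).mpr fun n hn => ⟨0, H.zero_mem, by
        rw [HahnSeries.C_apply, HahnSeries.coeff_single] at hn
        split_ifs at hn with h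
        · exact h.symm
        · exact absurd rfl hn⟩)

theorem algebraMap_semigroupRingConst (c : K) :
    algebraMap R (LaurentSeries K) (semigroupRingConst K H R c) = HahnSeries.single 0 c := by
  exact congrArg Subtype.val ((RingEquiv.ofBijective (algebraMap R (LaurentSeries K)).rangeRestrict
    ⟨fun _ _ h => algebraMap_injective H (Subtype.ext_iff.mp h),
      RingHom.rangeRestrict_surjective _⟩).apply_symm_apply _)

theorem residue_semigroupRingConst [IsLocalRing R] (r : R) :
    residue R (semigroupRingConst K H R ((algebraMap R (LaurentSeries K) r).coeff 0)) =
      residue R r := by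
  rw [← sub_eq_zero, ← map_sub, residue_eq_zero_iff, mem_maximalIdeal_iff_coeff_zero (K := K) H,
    map_sub, algebraMap_semigroupRingConst, HahnSeries.coeff_sub, HahnSeries.coeff_single_same,
    sub_self]

theorem exists_semigroupMonomial {h : ℕ} (hh : h ∈ H) :
    ∃ r : R, algebraMap R (LaurentSeries K) r = HahnSeries.single (h : ℤ) 1 :=
  exists_algebraMap_eq H fun n hn => ⟨h, hh, by
    rw [HahnSeries.coeff_single] at hn
    split_ifs at hn with h
    · exact h.symm
    · exact absurd rfl hn⟩

/-- A set of integers is stable under `H` if it is closed under adding elements of `H`. -/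
def IsStable (H : AddSubmonoid ℕ) (A : Set ℤ) : Prop := ∀ h ∈ H, ∀ a ∈ A, a + (h : ℤ) ∈ A

/-- The submodule of `K((t))` of the Laurent series with exponents in `A`. -/
def monomialModule (K : Type u) [Field K] {H : AddSubmonoid ℕ} (R : Type u) [CommRing R]
    [Algebra R (LaurentSeries K)] [IsSemigroupRing K H R] {A : Set ℤ} (hA : IsStable H A) :
    Submodule R (LaurentSeries K) where
  carrier := {f | ∀ n, f.coeff n ≠ 0 → n ∈ A}
  zero_mem' n hn := absurd HahnSeries.coeff_zero hn
  add_mem' {f g} hf hg n hn := by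
    by_cases h : f.coeff n = 0
    · refine hg n fun h' => hn ?_
      rw [HahnSeries.coeff_add, h, h', add_zero]
    · exact hf n h
  smul_mem' r f hf n hn := by
    obtain ⟨k, hk, -, h⟩ := exists_of_coeff_smul_ne_zero H hn
    simpa using hA k hk _ (hf _ h)

variable {H}

theorem coeff_eq_zero_of_mem_monomialModule {A : Set ℤ} {hA : IsStable H A} {f : LaurentSeries K}
    (hf : f ∈ monomialModule K R hA) {n : ℤ} (hn : n ∉ A) : f.coeff n = 0 :=
  by_contra fun h => hn (hf n h)

theorem single_mem_monomialModule {A : Set ℤ} {hA : IsStable H A} {a : ℤ} (ha : a ∈ A) (c : K) :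
    HahnSeries.single a c ∈ monomialModule K R hA := by
  intro n hn
  rw [HahnSeries.coeff_single] at hn
  split_ifs at hn with h
  · rwa [h]
  · exact absurd rfl hn

theorem length_residueField (R : Type*) [CommRing R] [IsLocalRing R] :
    Module.length R (ResidueField R) = 1 := by
  rw [Module.length_eq_of_surjective (R := ResidueField R) residue_surjective]
  exact Module.length_eq_one _ _

variable [IsLocalRing R]

/-- Taking the coefficient at an exponent `b ∈ B` such that `B \ {b}` is stable. -/
noncomputable def coeffResidue (K : Type u) [Field K] {H : AddSubmonoid ℕ} (R : Type u) [CommRing R]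
    [Algebra R (LaurentSeries K)] [IsSemigroupRing K H R] [IsLocalRing R] {B : Set ℤ}
    (hB : IsStable H B) {b : ℤ} (hb : IsStable H (B \ {b})) :
    monomialModule K R hB →ₗ[R] ResidueField R where
  toFun f := residue R (semigroupRingConst K H R ((f : LaurentSeries K).coeff b))
  map_add' f g := by simp
  map_smul' r f := by
    have h := coeff_smul_eq H r (f := (f : LaurentSeries K)) (n := b) fun k hk hk0 => by
      by_contra hne
      have := hb k hk (b - k) ⟨f.2 _ hne, by simpa using hk0⟩
      simp at this
    rw [Submodule.coe_smul, h, map_mul, map_mul, RingHom.id_apply, Algebra.smul_def,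
      ResidueField.algebraMap_eq, residue_semigroupRingConst]

theorem coeffResidue_eq_zero_iff {B : Set ℤ} (hB : IsStable H B) {b : ℤ}
    (hb : IsStable H (B \ {b})) (f : monomialModule K R hB) :
    coeffResidue K R hB hb f = 0 ↔ (f : LaurentSeries K).coeff b = 0 :=
  map_eq_zero_iff _ (RingHom.injective ((residue R).comp (semigroupRingConst K H R)))

theorem coeffResidue_surjective {B : Set ℤ} (hB : IsStable H B) {b : ℤ} (hbB : b ∈ B)
    (hb : IsStable H (B \ {b})) : Function.Surjective (coeffResidue K R hB hb) := by
  intro y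
  obtain ⟨r, rfl⟩ := residue_surjective y
  refine ⟨⟨HahnSeries.single b ((algebraMap R (LaurentSeries K) r).coeff 0),
    single_mem_monomialModule hbB _⟩, ?_⟩
  rw [← residue_semigroupRingConst (K := K) H r]
  simp [coeffResidue]

/-- `N` plays the role of the quotient of the `B`-module by the `A`-module. In the induction on the
size of `B \ A`, its least element `b` is removed. The set `B \ {b}` stays stable: if `b = a + h`
with `a ≠ b`, then `a ∈ A` would give `b ∈ A`, and `a ∈ B \ A` would contradict minimality. The
coefficient at `b` splits off one copy of the residue field. -/
theorem length_of_surjective_of_ker {A B : Set ℤ} (hA : IsStable H A) (hB : IsStable H B)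
    (hAB : A ⊆ B) (hfin : (B \ A).Finite) {N : Type u} [AddCommGroup N]
    [Module R N] (φ : monomialModule K R hB →ₗ[R] N)
    (hφ : Function.Surjective φ)
    (hker : ∀ f, φ f = 0 ↔ (f : LaurentSeries K) ∈ monomialModule K R hA) :
    Module.length R N = (B \ A).ncard := by
  obtain ⟨n, hn⟩ : ∃ n, (B \ A).ncard = n := ⟨_, rfl⟩
  induction n generalizing B N with
  | zero =>
    rw [hn, Nat.cast_zero, Module.length_eq_zero_iff]
    have hBA : B \ A = ∅ := (Set.ncard_eq_zero hfin).mp hn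
    have hBA : B ⊆ A := Set.sdiff_eq_empty.mp hBA
    have h : ∀ y : N, y = 0 := fun y => by
      obtain ⟨f, rfl⟩ := hφ y
      exact (hker f).mpr fun k hk => hBA (f.2 k hk)
    exact ⟨fun x y => by rw [h x, h y]⟩
  | succ n ih =>
    have hne : (B \ A).Nonempty := Set.nonempty_of_ncard_ne_zero (by omega)
    obtain ⟨b, ⟨hbB, hbA⟩, hmin⟩ := Set.exists_min_image _ id hfin hne
    have hB' : IsStable H (B \ {b}) := by
      rintro h hh a ⟨ha, hab⟩
      refine ⟨hB h hh a ha, fun hb => ?_⟩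
      rw [Set.mem_singleton_iff] at hab hb
      by_cases haA : a ∈ A
      · exact hbA (hb ▸ hA h hh a haA)
      · have := hmin a ⟨ha, haA⟩
        simp only [id] at this
        omega
    have hle : monomialModule K R hB' ≤ monomialModule K R hB := fun f hf k hk => (hf k hk).1
    have hdiff : (B \ {b}) \ A = (B \ A) \ {b} := by ext; simp; tauto
    have hcard : ((B \ A) \ {b}).ncard = n := by
      rw [Set.ncard_sdiff_singleton_of_mem (show b ∈ B \ A from ⟨hbB, hbA⟩)]
      omega
    let c := coeffResidue K R hB hB'
    have hcs : Function.Surjective c := coeffResidue_surjective (K := K) (R := R) hB hbB hB'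
    have hc : ∀ f, c f = 0 ↔ (f : LaurentSeries K) ∈ monomialModule K R hB' := fun f => by
      rw [coeffResidue_eq_zero_iff]
      refine ⟨fun hf k hk => ⟨f.2 k hk, fun hkb => hk ?_⟩, fun hf =>
        coeff_eq_zero_of_mem_monomialModule hf fun h => h.2 rfl⟩
      rw [Set.mem_singleton_iff] at hkb
      rwa [hkb]
    have hφc : LinearMap.ker φ ≤ LinearMap.ker c := fun f hf =>
      (hc f).mpr fun k hk => ⟨f.2 k hk, fun hkb => hbA (hkb ▸ (hker f).mp hf k hk)⟩
    let ψ : monomialModule K R hB' →ₗ[R] (LinearMap.ker c).map φ :=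
      (φ.comp (Submodule.inclusion hle)).codRestrict _
        fun f => ⟨Submodule.inclusion hle f, (hc _).mpr f.2, rfl⟩
    have hψ : Function.Surjective ψ := by
      rintro ⟨_, f, hf, rfl⟩
      exact ⟨⟨f, (hc f).mp hf⟩, rfl⟩
    have hlen := length_eq_length_map_ker_add (φ := φ) (c := c) hφ hcs hφc
    have hn' : ((B \ {b}) \ A).ncard = n := by rw [hdiff, hcard]
    have hN' := ih hB' (fun a ha => ⟨hAB ha, fun h => hbA (h ▸ ha)⟩)
      (hdiff ▸ hfin.subset (fun _ h => h.1)) ψ hψ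
      (fun f => Subtype.ext_iff.trans (hker (Submodule.inclusion hle f))) hn'
    rw [hlen, length_residueField, hN', hn', hn]
    rfl

end MonomialModule

/-! ### Finite generation by Apéry elements. -/

section MonomialSpan

open IsLocalRing IsSemigroupRing

universe u

variable {K : Type u} [Field K] (H : AddSubmonoid ℕ) {R : Type u} [CommRing R]
  [Algebra R (LaurentSeries K)] [IsSemigroupRing K H R]

theorem isStable_range : IsStable H {n : ℤ | ∃ h ∈ H, (h : ℤ) = n} := by
  rintro k hk _ ⟨h, hh, rfl⟩
  exact ⟨h + k, H.add_mem hh hk, by push_cast; rfl⟩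

theorem algebraMap_mem_monomialModule (r : R) :
    algebraMap R (LaurentSeries K) r ∈ monomialModule K R (isStable_range H) :=
  fun _ hn => exists_of_coeff_algebraMap_ne_zero H hn

theorem range_linearMap_eq_monomialModule :
    LinearMap.range (Algebra.linearMap R (LaurentSeries K)) =
      monomialModule K R (isStable_range H) := by
  refine le_antisymm ?_ fun f hf => exists_algebraMap_eq H hf
  rintro _ ⟨r, rfl⟩
  exact algebraMap_mem_monomialModule H r

/-- The semigroup ring as a module of Laurent series. -/
noncomputable def monomialModuleEquiv (K : Type u) [Field K] (H : AddSubmonoid ℕ) (R : Type u)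
    [CommRing R] [Algebra R (LaurentSeries K)] [IsSemigroupRing K H R] :
    R ≃ₗ[R] monomialModule K R (isStable_range H) :=
  LinearEquiv.ofBijective ((Algebra.linearMap R (LaurentSeries K)).codRestrict _
    (algebraMap_mem_monomialModule H))
    ⟨fun _ _ h => algebraMap_injective H (Subtype.ext_iff.mp h), fun f => by
      obtain ⟨r, hr⟩ := exists_algebraMap_eq (R := R) H f.2
      exact ⟨r, Subtype.ext hr⟩⟩

theorem algebraMap_monomialModuleEquiv_symm (f : monomialModule K R (isStable_range H)) :
    algebraMap R (LaurentSeries K) ((monomialModuleEquiv K H R).symm f) = f :=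
  congrArg Subtype.val ((monomialModuleEquiv K H R).apply_symm_apply f)

variable {H}

/-- If `b` exceeded `a` in the same class mod `e`, then `b - e` would be `a` plus a nonnegative
multiple of `e`. Thus each class contains at most one `a ∈ A` with `a - e ∉ A`. -/
theorem le_of_dvd_sub_of_sub_notMem {A : Set ℤ} (hA : IsStable H A) {e : ℕ} (he : e ∈ H) {a b : ℤ}
    (ha : a ∈ A) (hb : b - e ∉ A) (hab : (e : ℤ) ∣ b - a) : b ≤ a := by
  by_contra! hlt
  obtain ⟨k, hk⟩ := hab
  have hk0 : 0 < k := by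
    by_contra! h
    have : (e : ℤ) * k ≤ 0 := mul_nonpos_of_nonneg_of_nonpos (by omega) h
    omega
  refine hb ?_
  have h2 := hA ((k - 1).toNat * e) (by simpa using H.nsmul_mem he (k - 1).toNat) a ha
  push_cast at h2
  rw [Int.toNat_of_nonneg (by omega)] at h2
  convert h2 using 1
  linear_combination hk

theorem finite_stable_sub {A : Set ℤ} (hA : IsStable H A) {e : ℕ} (he : e ∈ H)
    (he0 : e ≠ 0) : {a ∈ A | a - e ∉ A}.Finite := by
  refine Set.Finite.of_injOn (f := fun a : ℤ => a % e) (t := Set.Ico 0 (e : ℤ)) (fun a _ => ?_) ?_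
    (Set.finite_Ico _ _)
  · exact ⟨Int.emod_nonneg _ (by omega), Int.emod_lt_of_pos _ (by omega)⟩
  · rintro a ⟨ha, ha'⟩ b ⟨hb, hb'⟩ hab
    exact le_antisymm (le_of_dvd_sub_of_sub_notMem hA he hb ha' (Int.ModEq.dvd hab.symm))
      (le_of_dvd_sub_of_sub_notMem hA he ha hb' (Int.ModEq.dvd hab))

theorem exists_sub_mul_mem {A : Set ℤ} (hbdd : BddBelow A) {e : ℕ} (he0 : e ≠ 0) {n : ℤ}
    (hn : n ∈ A) : ∃ k : ℕ, n - k * e ∈ A ∧ n - k * e - e ∉ A := by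
  obtain ⟨N, hN⟩ := hbdd
  by_contra! h
  have hall : ∀ k : ℕ, n - k * e ∈ A := by
    intro k
    induction k with
    | zero => simpa using hn
    | succ k ih =>
      have := h k ih
      push_cast
      rwa [add_mul, one_mul, ← sub_sub]
  have h1 := hN (hall (n - N + 1).toNat)
  have h2 : (((n - N + 1).toNat : ℕ) : ℤ) * e ≥ (n - N + 1).toNat := by
    exact_mod_cast Nat.le_mul_of_pos_right _ (Nat.pos_of_ne_zero he0)
  omega

/-- Each `n ∈ A` is uniquely `a + k e` with `k ≥ 0` and `a` an Apéry element of `A`. Grouping the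
terms of `f` by `a` gives a finite sum of `r_a • t ^ a`, where `r_a` is a series in `t ^ e` and so
lies in `R`. -/
theorem monomialModule_eq_span {A : Set ℤ} (hA : IsStable H A) (hbdd : BddBelow A) {e : ℕ}
    (he : e ∈ H) (he0 : e ≠ 0) :
    monomialModule K R hA =
      Submodule.span R ((fun a => HahnSeries.single a 1) '' {a ∈ A | a - e ∉ A}) := by
  refine le_antisymm (fun f hf => ?_) (Submodule.span_le.mpr ?_)
  · set T := (finite_stable_sub hA he he0).toFinset with hT
    have hr : ∀ a : ℤ, ∃ r : R, algebraMap R (LaurentSeries K) r =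
        HahnSeries.ofPowerSeries ℤ K (PowerSeries.mk fun n => if e ∣ n then f.coeff (a + n) else 0) := by
      refine fun a => exists_algebraMap_eq H fun n hn => ?_
      rw [PowerSeries.coeff_coe] at hn
      split_ifs at hn with h
      · exact absurd rfl hn
      · rw [PowerSeries.coeff_mk] at hn
        split_ifs at hn with h'
        · obtain ⟨k, hk⟩ := h'
          refine ⟨n.natAbs, ?_, by omega⟩
          rw [hk, mul_comm]
          simpa using H.nsmul_mem he k
        · exact absurd rfl hn
    choose r hr using hr
    have hcoeff : ∀ a n : ℤ, (r a • HahnSeries.single a (1 : K)).coeff n =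
        if a ≤ n ∧ (e : ℤ) ∣ n - a then f.coeff n else 0 := by
      intro a n
      rw [Algebra.smul_def, hr, HahnSeries.coeff_mul_single, mul_one, PowerSeries.coeff_coe]
      by_cases h : n - a < 0
      · rw [if_pos h, if_neg fun h' => by omega]
      · have h3 : a + ((n - a).natAbs : ℤ) = n := by omega
        rw [if_neg h, PowerSeries.coeff_mk, h3]
        refine if_congr ?_ rfl rfl
        rw [← Int.natCast_dvd]
        exact ⟨fun h' => ⟨by omega, h'⟩, fun h' => h'.2⟩
    have hf' : f = ∑ a ∈ T, r a • HahnSeries.single a (1 : K) := by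
      ext n
      rw [HahnSeries.coeff_sum, Finset.sum_congr rfl fun a _ => hcoeff a n]
      by_cases hn : n ∈ A
      · obtain ⟨k, hk, hk'⟩ := exists_sub_mul_mem hbdd he0 hn
        have hke : (0 : ℤ) ≤ k * e := by positivity
        rw [Finset.sum_eq_single (n - k * e), if_pos ⟨by omega, by simp⟩]
        · intro b hb hne
          rw [if_neg]
          rintro ⟨hbn, hdvd⟩
          obtain ⟨hbA, hbA'⟩ := (Set.Finite.mem_toFinset _).mp hb
          have h1 : (e : ℤ) ∣ b - (n - k * e) := by
            have h2 : (e : ℤ) ∣ -(n - b) + k * e := dvd_add (dvd_neg.mpr hdvd) (dvd_mul_left _ _)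
            rwa [show b - (n - k * e) = -(n - b) + k * e by ring]
          exact hne (le_antisymm (le_of_dvd_sub_of_sub_notMem hA he hk hbA' h1)
            (le_of_dvd_sub_of_sub_notMem hA he hbA hk' (by rw [← dvd_neg, neg_sub]; exact h1)))
        · intro h
          exact absurd ((Set.Finite.mem_toFinset _).mpr
            (show n - k * e ∈ {a ∈ A | a - e ∉ A} from ⟨hk, hk'⟩)) h
      · rw [coeff_eq_zero_of_mem_monomialModule hf hn]
        simp
    rw [hf']
    refine Submodule.sum_mem _ fun a ha => Submodule.smul_mem _ _ (Submodule.subset_span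
      ⟨a, (Set.Finite.mem_toFinset _).mp ha, rfl⟩)
  · rintro _ ⟨a, ha, rfl⟩
    exact single_mem_monomialModule ha.1 1

end MonomialSpan

/-! ### Socles, colengths and the multiplicity. -/

section SemigroupRingInvariants

open IsLocalRing IsSemigroupRing

universe u

variable {K : Type u} [Field K] {H : AddSubmonoid ℕ} {R : Type u} [CommRing R]
  [Algebra R (LaurentSeries K)] [IsSemigroupRing K H R]

theorem isStable_Ici (k : ℕ) : IsStable H {n : ℤ | (k : ℤ) ≤ n} := by
  intro h _ a ha
  simp only [Set.mem_ofPred_eq] at ha ⊢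
  omega

/-- The ideal of the series of order at least `k`. -/
noncomputable def orderIdeal (K : Type u) [Field K] (H : AddSubmonoid ℕ) (R : Type u) [CommRing R]
    [Algebra R (LaurentSeries K)] [IsSemigroupRing K H R] (k : ℕ) : Ideal R :=
  (monomialModule K R (isStable_Ici (H := H) k)).comap (Algebra.linearMap R (LaurentSeries K))

theorem orderIdeal_mul_le (a b : ℕ) :
    orderIdeal K H R a * orderIdeal K H R b ≤ orderIdeal K H R (a + b) := by
  refine Ideal.mul_le.mpr fun r hr s hs n hn => ?_
  rw [Algebra.linearMap_apply, map_mul] at hn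
  obtain ⟨i, j, rfl, hi, hj⟩ := exists_of_coeff_mul_ne_zero hn
  have h1 : (a : ℤ) ≤ i := hr i hi
  have h2 : (b : ℤ) ≤ j := hs j hj
  simp only [Set.mem_ofPred_eq]
  push_cast
  omega

/-- Dividing by `t ^ e` leaves exponents at least `c`, all of which belong to `H`. -/
theorem exists_algebraMap_eq_single_mul {e c : ℕ} (hc : ∀ n, c ≤ n → n ∈ H)
    {r : R} (hr : r ∈ orderIdeal K H R (e + c)) (he : e ∈ H) :
    ∃ s x : R, algebraMap R (LaurentSeries K) s = HahnSeries.single (e : ℤ) 1 ∧ r = s * x := by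
  obtain ⟨s, hs⟩ := exists_semigroupMonomial (K := K) (R := R) H he
  obtain ⟨x, hx⟩ := exists_algebraMap_eq (R := R) H
    (f := HahnSeries.single (-(e : ℤ)) (1 : K) * algebraMap R (LaurentSeries K) r) fun n hn => by
      rw [HahnSeries.coeff_single_mul, one_mul] at hn
      have h1 : ((e + c : ℕ) : ℤ) ≤ n - -(e : ℤ) := hr _ hn
      push_cast at h1
      exact ⟨n.toNat, hc _ (by omega), by omega⟩
  refine ⟨s, x, hs, algebraMap_injective (K := K) H ?_⟩
  rw [map_mul, hs, hx, ← mul_assoc, HahnSeries.single_mul_single]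
  simp

variable [IsLocalRing R]

/-- The exponents `n` with `n + h ∈ A` for all nonzero `h ∈ H`. -/
def socleSet (H : AddSubmonoid ℕ) (A : Set ℤ) : Set ℤ := {n | ∀ h ∈ H, h ≠ 0 → n + (h : ℤ) ∈ A}

theorem subset_socleSet {A : Set ℤ} (hA : IsStable H A) : A ⊆ socleSet H A :=
  fun a ha h hh _ => hA h hh a ha

theorem isStable_socleSet {A : Set ℤ} (hA : IsStable H A) : IsStable H (socleSet H A) := by
  intro h hh a ha k hk hk0
  rw [add_right_comm]
  exact hA h hh _ (ha k hk hk0)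

/-- Testing against the monomials `t ^ h` with `0 ≠ h ∈ H` shows that the socle of `K((t))` modulo a
monomial module is itself monomial. It serves for `R`, giving the type, and for the canonical
module. -/
theorem length_torsion_quotient {A : Set ℤ} (hA : IsStable H A) (hfin : (socleSet H A \ A).Finite)
    {N : Submodule R (LaurentSeries K)} (hN : N = monomialModule K R hA) :
    Module.length R (Submodule.torsionBySet R (LaurentSeries K ⧸ N) (maximalIdeal R : Set R)) =
      (socleSet H A \ A).ncard := by
  subst hN
  let φ : monomialModule K R (isStable_socleSet hA) →ₗ[R]
      Submodule.torsionBySet R (LaurentSeries K ⧸ monomialModule K R hA) (maximalIdeal R : Set R) :=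
    ((monomialModule K R hA).mkQ.comp (Submodule.subtype _)).codRestrict _ fun f => by
      rw [Submodule.mem_torsionBySet_iff]
      rintro ⟨r, hr⟩
      refine (Submodule.Quotient.mk_eq_zero _).mpr fun n hn => ?_
      obtain ⟨k, hk, hrk, hf⟩ := exists_of_coeff_smul_ne_zero H hn
      have hk0 : k ≠ 0 := by
        rintro rfl
        exact hrk ((mem_maximalIdeal_iff_coeff_zero (K := K) H).mp hr)
      have := f.2 _ hf k hk hk0
      rwa [sub_add_cancel] at this
  refine length_of_surjective_of_ker hA (isStable_socleSet hA) (subset_socleSet hA) hfin φ ?_ ?_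
  · rintro ⟨x, hx⟩
    obtain ⟨f, rfl⟩ := Submodule.mkQ_surjective _ x
    refine ⟨⟨f, fun n hn h hh hh0 => ?_⟩, rfl⟩
    obtain ⟨r, hr⟩ := exists_semigroupMonomial (K := K) (R := R) H hh
    have hrm : r ∈ maximalIdeal R := by
      rw [mem_maximalIdeal_iff_coeff_zero (K := K) H, hr, HahnSeries.coeff_single_of_ne (by omega)]
    have h1 := (Submodule.Quotient.mk_eq_zero _).mp
      ((Submodule.mem_torsionBySet_iff _ _).mp hx ⟨r, hrm⟩)
    refine h1 (n + h) ?_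
    change (r • f).coeff (n + h) ≠ 0
    rw [Algebra.smul_def, hr, HahnSeries.coeff_single_mul, one_mul, add_sub_cancel_right]
    exact hn
  · intro f
    exact Subtype.ext_iff.trans (Submodule.Quotient.mk_eq_zero _)

theorem length_quotient_ideal {A : Set ℤ} (hA : IsStable H A) 
    (hAH : A ⊆ {n : ℤ | ∃ h ∈ H, (h : ℤ) = n}) 
    (hfin : ({n : ℤ | ∃ h ∈ H, (h : ℤ) = n} \ A).Finite) (I : Ideal R)
    (hI : ∀ r : R, r ∈ I ↔ algebraMap R (LaurentSeries K) r ∈ monomialModule K R hA) :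
    Module.length R (R ⧸ I) = ({n : ℤ | ∃ h ∈ H, (h : ℤ) = n} \ A).ncard := by
  refine length_of_surjective_of_ker hA (isStable_range H) hAH hfin
    (I.mkQ.comp (monomialModuleEquiv K H R).symm.toLinearMap)
    (I.mkQ_surjective.comp (monomialModuleEquiv K H R).symm.surjective) fun f => ?_
  refine (Submodule.Quotient.mk_eq_zero I).trans ?_
  rw [hI]
  exact iff_of_eq (congrArg (· ∈ _) (algebraMap_monomialModuleEquiv_symm H f))

theorem length_quotient_orderIdeal (k : ℕ) :
    Module.length R (R ⧸ orderIdeal K H R k) = {h ∈ H | h < k}.ncard := by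
  have hA : IsStable H ({n : ℤ | ∃ h ∈ H, (h : ℤ) = n} ∩ {n : ℤ | (k : ℤ) ≤ n}) :=
    fun h hh a ha => ⟨isStable_range H h hh a ha.1, isStable_Ici (H := H) k h hh a ha.2⟩
  have hdiff : {n : ℤ | ∃ h ∈ H, (h : ℤ) = n} \
      ({n : ℤ | ∃ h ∈ H, (h : ℤ) = n} ∩ {n : ℤ | (k : ℤ) ≤ n}) =
      (fun h : ℕ => (h : ℤ)) '' {h ∈ H | h < k} := by
    ext n
    constructor
    · rintro ⟨⟨h, hh, rfl⟩, hn⟩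
      exact ⟨h, ⟨hh, by_contra fun hk => hn ⟨⟨h, hh, rfl⟩, by simpa using hk⟩⟩, rfl⟩
    · rintro ⟨h, ⟨hh, hk⟩, rfl⟩
      refine ⟨⟨h, hh, rfl⟩, fun hn => ?_⟩
      have : (k : ℤ) ≤ h := hn.2
      omega
  rw [length_quotient_ideal (K := K) hA Set.inter_subset_left, hdiff,
    Set.ncard_image_of_injective _ Nat.cast_injective]
  · rw [hdiff]
    exact ((Set.finite_lt_nat k).subset fun h hh => hh.2).image _
  · exact fun r => ⟨fun hr n hn => ⟨exists_of_coeff_algebraMap_ne_zero H hn, hr n hn⟩,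
      fun hr n hn => (hr n hn).2⟩

theorem maximalIdeal_pow_le_orderIdeal {e : ℕ} (he : ∀ h ∈ H, h ≠ 0 → e ≤ h) (n : ℕ) :
    maximalIdeal R ^ n ≤ orderIdeal K H R (n * e) := by
  induction n with
  | zero =>
    intro r _ n hn
    obtain ⟨h, _, rfl⟩ := exists_of_coeff_algebraMap_ne_zero H hn
    simp
  | succ n ih =>
    rw [pow_succ, add_mul, one_mul]
    have hm : maximalIdeal R ≤ orderIdeal K H R e := by
      intro r hr n hn
      obtain ⟨h, hh, rfl⟩ := exists_of_coeff_algebraMap_ne_zero H hn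
      have : e ≤ h := he h hh (by
        rintro rfl
        exact hn ((mem_maximalIdeal_iff_coeff_zero (K := K) H).mp hr))
      simpa using this
    exact (Ideal.mul_mono ih hm).trans (orderIdeal_mul_le _ _)

theorem orderIdeal_le_maximalIdeal_pow {e c : ℕ} (he : e ∈ H) (he0 : e ≠ 0)
    (hc : ∀ n, c ≤ n → n ∈ H) (n : ℕ) : orderIdeal K H R (n * e + c) ≤ maximalIdeal R ^ n := by
  intro r hr
  obtain ⟨s, hs⟩ := exists_semigroupMonomial (K := K) (R := R) H he
  have hsm : s ∈ maximalIdeal R := by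
    rw [mem_maximalIdeal_iff_coeff_zero (K := K) H, hs, HahnSeries.coeff_single_of_ne (by omega)]
  obtain ⟨s', x, hs', rfl⟩ := exists_algebraMap_eq_single_mul hc hr (by simpa using H.nsmul_mem he n)
  have : s' = s ^ n := algebraMap_injective (K := K) H (by
    rw [hs', map_pow, hs, HahnSeries.single_pow]
    simp)
  rw [this]
  exact Ideal.mul_mem_right _ _ (Ideal.pow_mem_pow hsm n)

/-- With `c` such that all integers from `c` on lie in `H`, the power `𝔪 ^ n` lies between the
ideals of series of order at least `n e + c` and at least `n e`. The colength of the series of order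
at least `k` is the number of elements of `H` below `k`, which differs from `k` by at most the
number of gaps. So the length of `R / 𝔪 ^ n` is `n e + O(1)`. -/
theorem hasMultiplicity_of_isLeast (K : Type u) [Field K] {H : AddSubmonoid ℕ} (R : Type u)
    [CommRing R] [Algebra R (LaurentSeries K)] [IsSemigroupRing K H R] [IsLocalRing R] (hH : ((H : Set ℕ)ᶜ).Finite) 
    {e : ℕ} (he : IsLeast {h ∈ H | h ≠ 0} e) : HasMultiplicity R e := by
  obtain ⟨c, hc⟩ : ∃ c, ∀ n, c ≤ n → n ∈ H := by
    obtain ⟨c, hc⟩ := hH.bddAbove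
    refine ⟨c + 1, fun n hn => by_contra fun h => ?_⟩
    have := hc h
    omega
  have hup : ∀ n : ℕ, Module.length R (R ⧸ maximalIdeal R ^ n) ≤ ((n * e + c : ℕ) : ℕ∞) := fun n => by
    refine (Module.length_le_of_surjective (Submodule.factor
      (orderIdeal_le_maximalIdeal_pow (K := K) he.1.1 he.1.2 hc n))
      (Submodule.factor_surjective _)).trans ?_
    rw [length_quotient_orderIdeal]
    have h1 : {h ∈ H | h < n * e + c} ⊆ Set.Iio (n * e + c) := fun h hh => hh.2
    exact_mod_cast (Set.ncard_le_ncard h1 (Set.finite_lt_nat _)).trans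
      (Set.ncard_Iio_nat _).le
  have hlow : ∀ n : ℕ, ((n * e : ℕ) : ℕ∞) ≤
      Module.length R (R ⧸ maximalIdeal R ^ n) + (((H : Set ℕ)ᶜ).ncard : ℕ∞) := fun n => by
    have h1 := Module.length_le_of_surjective (Submodule.factor
      (maximalIdeal_pow_le_orderIdeal (K := K) (H := H) (R := R) (fun h hh h0 => he.2 ⟨hh, h0⟩) n))
      (Submodule.factor_surjective _)
    rw [length_quotient_orderIdeal] at h1
    refine le_trans ?_ (add_le_add_left h1 _)
    have h2 := Set.ncard_union_le {h ∈ H | h < n * e} ((H : Set ℕ)ᶜ)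
    have h3 : (Set.Iio (n * e)).ncard ≤ ({h ∈ H | h < n * e} ∪ (H : Set ℕ)ᶜ).ncard := by
      refine Set.ncard_le_ncard (fun h hh => ?_)
        (((Set.finite_lt_nat _).subset fun h hh => hh.2).union hH)
      by_cases hhH : h ∈ H
      · exact Or.inl ⟨hhH, hh⟩
      · exact Or.inr hhH
    rw [Set.ncard_Iio_nat] at h3
    exact_mod_cast h3.trans h2
  set g := ((H : Set ℕ)ᶜ).ncard
  set x : ℕ → ℕ := fun n => (Module.length R (R ⧸ maximalIdeal R ^ n)).toNat with hx
  have hx1 : ∀ n, x n ≤ n * e + c := fun n => ENat.toNat_le_of_le_natCast (hup n)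
  have hx2 : ∀ n, n * e ≤ x n + g := fun n => by
    have h1 := hlow n
    rw [← ENat.natCast_toNat (ne_top_of_le_ne_top (ENat.natCast_ne_top _) (hup n))] at h1
    exact_mod_cast h1
  have hl : ∀ a : ℝ, Filter.Tendsto (fun n : ℕ => (e : ℝ) + a / n) Filter.atTop (nhds (e : ℝ)) :=
    fun a => by simpa using (tendsto_const_div_atTop_nhds_zero_nat a).const_add (e : ℝ)
  refine tendsto_of_tendsto_of_tendsto_of_le_of_le' (hl (-g)) (hl c) ?_ ?_
  · filter_upwards [Filter.eventually_gt_atTop 0] with n hn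
    have hn' : (0 : ℝ) < n := by exact_mod_cast hn
    have h2 : ((n * e : ℕ) : ℝ) ≤ ((x n + g : ℕ) : ℝ) := by exact_mod_cast hx2 n
    push_cast at h2
    rw [← sub_nonneg]
    have : (x n : ℝ) / n - (e + -g / n) = (x n + g - n * e) / n := by field_simp; ring
    rw [this]
    exact div_nonneg (by linarith) hn'.le
  · filter_upwards [Filter.eventually_gt_atTop 0] with n hn
    have hn' : (0 : ℝ) < n := by exact_mod_cast hn
    have h2 : (x n : ℝ) ≤ ((n * e + c : ℕ) : ℝ) := by exact_mod_cast hx1 n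
    push_cast at h2
    rw [← sub_nonneg]
    have : (e : ℝ) + c / n - x n / n = (n * e + c - x n) / n := by field_simp
    rw [this]
    exact div_nonneg (by linarith) hn'.le

end SemigroupRingInvariants

/-! ### The embedding dimension counts indecomposable elements. -/

section EmbeddingDimension

open IsLocalRing IsSemigroupRing

universe u

variable (K : Type u) [Field K] {H : AddSubmonoid ℕ} (R : Type u) [CommRing R]
  [Algebra R (LaurentSeries K)] [IsSemigroupRing K H R] [IsLocalRing R]

/-- The minimal generators of a submonoid of `ℕ`: the nonzero elements that are not sums of two
nonzero elements. -/
def minimalGenerators (H : AddSubmonoid ℕ) : Set ℕ :=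
  {h ∈ H | h ≠ 0 ∧ ∀ a ∈ H, ∀ b ∈ H, a ≠ 0 → b ≠ 0 → a + b ≠ h}

theorem isStable_nonzero : IsStable H {n : ℤ | ∃ h ∈ H, h ≠ 0 ∧ (h : ℤ) = n} := by
  rintro k hk _ ⟨h, hh, h0, rfl⟩
  exact ⟨h + k, H.add_mem hh hk, by omega, by push_cast; rfl⟩

theorem isStable_decomposable :
    IsStable H {n : ℤ | ∃ a ∈ H, ∃ b ∈ H, a ≠ 0 ∧ b ≠ 0 ∧ ((a + b : ℕ) : ℤ) = n} := by
  rintro k hk _ ⟨a, ha, b, hb, ha0, hb0, rfl⟩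
  exact ⟨a, ha, b + k, H.add_mem hb hk, ha0, by omega, by push_cast; ring⟩

theorem mem_maximalIdeal_iff_mem_monomialModule {r : R} : r ∈ maximalIdeal R ↔
    algebraMap R (LaurentSeries K) r ∈ monomialModule K R (isStable_nonzero (H := H)) := by
  rw [mem_maximalIdeal_iff_coeff_zero (K := K) H]
  refine ⟨fun h n hn => ?_, fun h => coeff_eq_zero_of_mem_monomialModule h ?_⟩
  · obtain ⟨k, hk, rfl⟩ := exists_of_coeff_algebraMap_ne_zero H hn
    refine ⟨k, hk, ?_, rfl⟩
    rintro rfl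
    exact hn h
  · rintro ⟨k, _, hk0, hk⟩
    omega

theorem map_maximalIdeal :
    Submodule.map (Algebra.linearMap R (LaurentSeries K)) (maximalIdeal R) =
      monomialModule K R (isStable_nonzero (H := H)) := by
  ext f
  constructor
  · rintro ⟨r, hr, rfl⟩
    exact (mem_maximalIdeal_iff_mem_monomialModule K R).mp hr
  · intro hf
    obtain ⟨r, rfl⟩ := exists_algebraMap_eq (R := R) H (f := f) fun n hn => by
      obtain ⟨k, hk, -, h⟩ := hf n hn
      exact ⟨k, hk, h⟩
    exact ⟨r, (mem_maximalIdeal_iff_mem_monomialModule K R).mpr hf, rfl⟩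

variable {K R}

theorem exists_mem_maximalIdeal_algebraMap_eq {h : ℕ} (hh : h ∈ H) (h0 : h ≠ 0) :
    ∃ r ∈ maximalIdeal R, algebraMap R (LaurentSeries K) r = HahnSeries.single (h : ℤ) 1 := by
  obtain ⟨r, hr⟩ := exists_semigroupMonomial (K := K) (R := R) H hh
  refine ⟨r, ?_, hr⟩
  rw [mem_maximalIdeal_iff_coeff_zero (K := K) H, hr, HahnSeries.coeff_single_of_ne (by omega)]

/-- The nontrivial inclusion holds because the module on the right is spanned over `R` by monomials
`t ^ (a + b) = t ^ a * t ^ b`, each a product of two elements of `𝔪`. -/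
theorem mem_maximalIdeal_sq_iff_mem_monomialModule {e : ℕ} (he : e ∈ H) (he0 : e ≠ 0) {r : R} :
    r ∈ maximalIdeal R ^ 2 ↔
      algebraMap R (LaurentSeries K) r ∈ monomialModule K R (isStable_decomposable (H := H)) := by
  constructor
  · intro hr
    have hle : maximalIdeal R ^ 2 ≤
        (monomialModule K R (isStable_decomposable (H := H))).comap (Algebra.linearMap R _) := by
      rw [pow_two]
      refine Ideal.mul_le.mpr fun x hx y hy n hn => ?_
      rw [Algebra.linearMap_apply, map_mul] at hn
      obtain ⟨i, j, rfl, hi, hj⟩ := exists_of_coeff_mul_ne_zero hn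
      obtain ⟨a, ha, ha0, rfl⟩ := (mem_maximalIdeal_iff_mem_monomialModule (H := H) K R).mp hx i hi
      obtain ⟨b, hb, hb0, rfl⟩ := (mem_maximalIdeal_iff_mem_monomialModule (H := H) K R).mp hy j hj
      exact ⟨a, ha, b, hb, ha0, hb0, by push_cast; rfl⟩
    exact hle hr
  · intro hr
    have hbdd : BddBelow {n : ℤ | ∃ a ∈ H, ∃ b ∈ H, a ≠ 0 ∧ b ≠ 0 ∧ ((a + b : ℕ) : ℤ) = n} := by
      refine ⟨0, ?_⟩
      rintro _ ⟨a, _, b, _, _, _, rfl⟩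
      positivity
    have hle : monomialModule K R (isStable_decomposable (H := H)) ≤
        Submodule.map (Algebra.linearMap R _) (maximalIdeal R ^ 2) := by
      rw [monomialModule_eq_span _ hbdd he he0, Submodule.span_le]
      rintro _ ⟨_, ⟨⟨a, ha, b, hb, ha0, hb0, rfl⟩, -⟩, rfl⟩
      obtain ⟨x, hx, hxa⟩ := exists_mem_maximalIdeal_algebraMap_eq (K := K) (R := R) ha ha0
      obtain ⟨y, hy, hyb⟩ := exists_mem_maximalIdeal_algebraMap_eq (K := K) (R := R) hb hb0
      refine ⟨x * y, by rw [pow_two]; exact Ideal.mul_mem_mul hx hy, ?_⟩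
      rw [Algebra.linearMap_apply, map_mul, hxa, hyb, HahnSeries.single_mul_single, mul_one]
      push_cast
      rfl
    obtain ⟨s, hs, hsr⟩ := hle hr
    rwa [← algebraMap_injective (K := K) H hsr]

theorem maximalIdeal_fg (K : Type u) [Field K] {H : AddSubmonoid ℕ} (R : Type u) [CommRing R]
    [Algebra R (LaurentSeries K)] [IsSemigroupRing K H R] [IsLocalRing R] {e : ℕ} (he : e ∈ H)
    (he0 : e ≠ 0) : (maximalIdeal R).FG := by
  have hbdd : BddBelow {n : ℤ | ∃ h ∈ H, h ≠ 0 ∧ (h : ℤ) = n} := by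
    refine ⟨0, ?_⟩
    rintro _ ⟨a, _, _, rfl⟩
    positivity
  have h : (Submodule.map (Algebra.linearMap R (LaurentSeries K)) (maximalIdeal R)).FG := by
    rw [map_maximalIdeal K (H := H) R, monomialModule_eq_span _ hbdd he he0]
    exact Submodule.fg_span ((finite_stable_sub isStable_nonzero he he0).image _)
  exact Submodule.fg_of_fg_map_injective (Algebra.linearMap R (LaurentSeries K)) (algebraMap_injective (K := K) H) h

/-- By Nakayama the embedding dimension is the length of `𝔪 / 𝔪 ^ 2`, a quotient of two monomial
modules whose exponent sets differ exactly by the indecomposable elements. -/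
theorem embeddingDim_eq_ncard (K : Type u) [Field K] {H : AddSubmonoid ℕ} (R : Type u) [CommRing R]
    [Algebra R (LaurentSeries K)] [IsSemigroupRing K H R] [IsLocalRing R] {e : ℕ} (he : e ∈ H)
    (he0 : e ≠ 0) (hfin : (minimalGenerators H).Finite) :
    embeddingDim R = (minimalGenerators H).ncard := by
  have hfg := maximalIdeal_fg K (H := H) R he he0
  have hdiff : {n : ℤ | ∃ h ∈ H, h ≠ 0 ∧ (h : ℤ) = n} \
      {n : ℤ | ∃ a ∈ H, ∃ b ∈ H, a ≠ 0 ∧ b ≠ 0 ∧ ((a + b : ℕ) : ℤ) = n} =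
      (fun h : ℕ => (h : ℤ)) '' minimalGenerators H := by
    ext n
    constructor
    · rintro ⟨⟨h, hh, h0, rfl⟩, hn⟩
      exact ⟨h, ⟨hh, h0, fun a ha b hb ha0 hb0 hab => hn ⟨a, ha, b, hb, ha0, hb0, by rw [hab]⟩⟩, rfl⟩
    · rintro ⟨h, ⟨hh, h0, hne⟩, rfl⟩
      refine ⟨⟨h, hh, h0, rfl⟩, ?_⟩
      rintro ⟨a, ha, b, hb, ha0, hb0, hab⟩
      exact hne a ha b hb ha0 hb0 (Nat.cast_injective hab)
  let e₁ : maximalIdeal R ≃ₗ[R] monomialModule K R (isStable_nonzero (H := H)) :=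
    (Submodule.equivMapOfInjective (Algebra.linearMap R (LaurentSeries K))
      (algebraMap_injective (K := K) H) _).trans
      (LinearEquiv.ofEq _ _ (map_maximalIdeal K R))
  have hlen : Module.length R (maximalIdeal R).Cotangent = (minimalGenerators H).ncard := by
    rw [length_of_surjective_of_ker isStable_decomposable isStable_nonzero ?_ ?_
      ((maximalIdeal R).toCotangent.comp e₁.symm.toLinearMap)
      ((Ideal.toCotangent_surjective _).comp e₁.symm.surjective) ?_, hdiff,
      Set.ncard_image_of_injective _ Nat.cast_injective]
    · rintro _ ⟨a, ha, b, hb, ha0, hb0, rfl⟩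
      exact ⟨a + b, H.add_mem ha hb, by omega, rfl⟩
    · rw [hdiff]
      exact hfin.image _
    · intro f
      obtain ⟨r, rfl⟩ := e₁.surjective f
      rw [LinearMap.comp_apply, LinearEquiv.coe_coe, e₁.symm_apply_apply, Ideal.toCotangent_eq_zero]
      exact mem_maximalIdeal_sq_iff_mem_monomialModule he he0
  rw [embeddingDim, spanFinrank_maximalIdeal_eq_finrank_cotangentSpace_of_fg hfg]
  have hfin' : Module.Finite R (maximalIdeal R).Cotangent :=
    haveI : Module.Finite R (maximalIdeal R) := Module.Finite.iff_fg.mpr hfg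
    Module.Finite.of_surjective _ (Ideal.toCotangent_surjective _)
  have : Module.Finite (ResidueField R) (CotangentSpace R) :=
    Module.Finite.of_restrictScalars_finite R _ _
  have h1 := Module.length_eq_finrank (ResidueField R) (CotangentSpace R)
  rw [← Module.length_eq_of_surjective (S := R) residue_surjective] at h1
  exact_mod_cast h1.symm.trans hlen

end EmbeddingDimension

/-! ### The pairing `(f, g) ↦ coeff F (f * g)` and the canonical module. -/

section CanonicalDuality

open IsLocalRing IsSemigroupRing

universe u

variable {K : Type u} [Field K]

theorem exists_lowerBound_coeff (f : LaurentSeries K) : ∃ N : ℤ, ∀ n, f.coeff n ≠ 0 → N ≤ n :=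
  ⟨f.order, fun _ hn => HahnSeries.order_le_of_coeff_ne_zero hn⟩

theorem lowerBound_coeff_mul {f g : LaurentSeries K} {a b : ℤ} (hf : ∀ n, f.coeff n ≠ 0 → a ≤ n)
    (hg : ∀ n, g.coeff n ≠ 0 → b ≤ n) : ∀ n, (f * g).coeff n ≠ 0 → a + b ≤ n := by
  intro n hn
  obtain ⟨i, j, rfl, hi, hj⟩ := exists_of_coeff_mul_ne_zero hn
  exact add_le_add (hf i hi) (hg j hj)

/-- A Laurent series is a finite combination of monomials plus a tail of order at least `N`. -/
theorem linearMap_eq_of_single {ψ χ : LaurentSeries K →ₗ[K] K} {N : ℤ}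
    (hN : ∀ f : LaurentSeries K, (∀ n, f.coeff n ≠ 0 → N ≤ n) → ψ f = χ f)
    (hs : ∀ n, ψ (HahnSeries.single n 1) = χ (HahnSeries.single n 1)) : ψ = χ := by
  have key : ∀ (j : ℕ) (f : LaurentSeries K), (∀ n, f.coeff n ≠ 0 → N - j ≤ n) → ψ f = χ f := by
    intro j
    induction j with
    | zero => intro f hf; exact hN f (by simpa using hf)
    | succ j ih =>
      intro f hf
      set a := f.coeff (N - j - 1)
      have h1 := ih (f - a • HahnSeries.single (N - j - 1) 1) fun n hn => by
        rw [HahnSeries.coeff_sub, HahnSeries.coeff_smul, HahnSeries.coeff_single] at hn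
        split_ifs at hn with h
        · rw [h] at hn
          simp [a] at hn
        · have := hf n (by simpa using hn)
          push_cast at this
          omega
      rw [map_sub, map_sub, map_smul, map_smul, hs] at h1
      exact sub_left_injective h1
  ext f
  obtain ⟨M, hM⟩ := exists_lowerBound_coeff f
  exact key (N - M).toNat f fun n hn => by
    have := hM n hn
    omega

/-- The linear form `x ↦ coeff F (u * x)`. -/
noncomputable def coeffMul (F : ℤ) (u : LaurentSeries K) : LaurentSeries K →ₗ[K] K where
  toFun x := (u * x).coeff F
  map_add' x y := by rw [mul_add, HahnSeries.coeff_add]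
  map_smul' c x := by 
    rw [← HahnSeries.C_mul_eq_smul, mul_left_comm, HahnSeries.C_mul_eq_smul, HahnSeries.coeff_smul,
      RingHom.id_apply]

/-- A linear form vanishing on all series of large order is `t`-adically continuous, hence given by
the pairing. The coefficient of `u` at `k` must be `ψ(t ^ (F - k))`, which is zero once `F - k ≥ N`,
so the support of `u` is bounded below. -/
theorem exists_eq_coeff_mul (F : ℤ) (ψ : LaurentSeries K →ₗ[K] K) {N : ℤ}
    (hN : ∀ f : LaurentSeries K, (∀ n, f.coeff n ≠ 0 → N ≤ n) → ψ f = 0) :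
    ∃ u : LaurentSeries K, ∀ x, ψ x = (u * x).coeff F := by
  let u : LaurentSeries K := HahnSeries.ofSuppBddBelow
    (fun k => ψ (HahnSeries.single (F - k) 1)) ⟨F - N, fun k hk => by
      by_contra! hlt
      refine hk (hN _ fun n hn => ?_)
      rw [HahnSeries.coeff_single] at hn
      split_ifs at hn with h
      · omega
      · exact absurd rfl hn⟩
  have hu : ∀ k, u.coeff k = ψ (HahnSeries.single (F - k) 1) := fun k => rfl
  refine ⟨u, fun x => ?_⟩
  refine DFunLike.congr_fun (linearMap_eq_of_single (ψ := ψ) (χ := coeffMul F u) (N := N)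
    (fun f hf => ?_) fun n => ?_) x
  · rw [hN f hf]
    by_contra hne
    obtain ⟨i, j, hij, hi, hj⟩ := exists_of_coeff_mul_ne_zero (Ne.symm hne)
    refine hi ((hu i).trans (hN _ fun n hn => ?_))
    rw [HahnSeries.coeff_single] at hn
    split_ifs at hn with h
    · have := hf j hj
      omega
    · exact absurd rfl hn
  · change _ = (u * HahnSeries.single n 1).coeff F
    rw [HahnSeries.coeff_mul_single, mul_one, hu, sub_sub_cancel]

/-- For any nonzero `i ∈ I`, the map `g` is multiplication by `i⁻¹ * g(i)`. -/
theorem baer_laurentSeries {R : Type u} [CommRing R] [Algebra R (LaurentSeries K)]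
    (hinj : Function.Injective (algebraMap R (LaurentSeries K))) :
    Module.Baer R (LaurentSeries K) := by
  intro I g
  by_cases hI : I = ⊥
  · subst hI
    refine ⟨0, fun x hx => ?_⟩
    have h0 : (⟨x, hx⟩ : (⊥ : Ideal R)) = 0 := Subtype.ext hx
    rw [h0, map_zero, LinearMap.zero_apply]
  · obtain ⟨i, hi, hi0⟩ := Submodule.exists_mem_ne_zero_of_ne_bot hI
    have hi' : algebraMap R (LaurentSeries K) i ≠ 0 := fun h => hi0 (hinj (by rw [h, map_zero]))
    refine ⟨LinearMap.toSpanSingleton R _ ((algebraMap R (LaurentSeries K) i)⁻¹ * g ⟨i, hi⟩),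
      fun x hx => ?_⟩
    have h1 : x • g ⟨i, hi⟩ = i • g ⟨x, hx⟩ := by
      rw [← map_smul, ← map_smul]
      exact congrArg g (Subtype.ext (mul_comm _ _))
    rw [Algebra.smul_def, Algebra.smul_def] at h1
    rw [LinearMap.toSpanSingleton_apply, Algebra.smul_def, mul_left_comm, h1, inv_mul_cancel_left₀ hi']

/-- The exponents of the canonical module of `K[|H|]`, where `F` is the Frobenius number of `H`. -/
def canonicalSet (H : AddSubmonoid ℕ) (F : ℤ) : Set ℤ := {n | ¬∃ h ∈ H, (h : ℤ) = F - n}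

theorem isStable_canonicalSet (H : AddSubmonoid ℕ) (F : ℤ) : IsStable H (canonicalSet H F) := by
  rintro k hk n hn ⟨h, hh, hF⟩
  exact hn ⟨h + k, H.add_mem hh hk, by push_cast; omega⟩

variable {H : AddSubmonoid ℕ} {R : Type u} [CommRing R] [Algebra R (LaurentSeries K)]
  [IsSemigroupRing K H R]

/-- The canonical module is the orthogonal of `R`. For the converse, a nonzero coefficient of `f` at
`n = F - h` is detected by pairing with `t ^ h`. -/
theorem mem_canonical_iff {F : ℤ} {f : LaurentSeries K} :
    f ∈ monomialModule K R (isStable_canonicalSet H F) ↔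
      ∀ r : R, (algebraMap R (LaurentSeries K) r * f).coeff F = 0 := by
  constructor
  · intro hf r
    rw [← Algebra.smul_def]
    refine coeff_eq_zero_of_mem_monomialModule (Submodule.smul_mem _ r hf) fun h => ?_
    exact h ⟨0, H.zero_mem, by simp⟩
  · rintro hf n hn ⟨h, hh, hF⟩
    obtain ⟨r, hr⟩ := exists_semigroupMonomial (K := K) (R := R) H hh
    have := hf r
    rw [hr, HahnSeries.coeff_single_mul, one_mul, hF, sub_sub_cancel] at this
    exact hn this

theorem semigroupRingConst_smul (c : K) (f : LaurentSeries K) :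
    semigroupRingConst K H R c • f = c • f := by
  rw [Algebra.smul_def, algebraMap_semigroupRingConst, ← HahnSeries.C_apply,
    HahnSeries.C_mul_eq_smul]

/-- The coefficient at `F`, on the quotient of `K((t))` by the canonical module. -/
noncomputable def quotientCoeff (F : ℤ)
    (y : LaurentSeries K ⧸ monomialModule K R (isStable_canonicalSet H F)) : K :=
  (Quotient.out y).coeff F

/-- The choice of representative is harmless because, `0` being in `H`, elements of the canonical
module have no coefficient at `F`. -/
theorem quotientCoeff_mk (F : ℤ) (f : LaurentSeries K) :
    quotientCoeff F ((monomialModule K R (isStable_canonicalSet H F)).mkQ f) = f.coeff F := by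
  have h : (monomialModule K R (isStable_canonicalSet H F)).mkQ
      (Quotient.out ((monomialModule K R (isStable_canonicalSet H F)).mkQ f)) =
      (monomialModule K R (isStable_canonicalSet H F)).mkQ f := Quotient.out_eq _
  have h1 := mem_canonical_iff.mp ((Submodule.Quotient.eq _).mp h) 1
  rw [map_one, one_mul, HahnSeries.coeff_sub, sub_eq_zero] at h1
  exact h1

theorem quotientCoeff_add (F : ℤ)
    (x y : LaurentSeries K ⧸ monomialModule K R (isStable_canonicalSet H F)) :
    quotientCoeff F (x + y) = quotientCoeff F x + quotientCoeff F y := by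
  obtain ⟨f, rfl⟩ := Submodule.mkQ_surjective _ x
  obtain ⟨g, rfl⟩ := Submodule.mkQ_surjective _ y
  rw [← map_add, quotientCoeff_mk, quotientCoeff_mk, quotientCoeff_mk, HahnSeries.coeff_add]

theorem quotientCoeff_smul (F : ℤ) (c : K)
    (x : LaurentSeries K ⧸ monomialModule K R (isStable_canonicalSet H F)) :
    quotientCoeff F (semigroupRingConst K H R c • x) = c * quotientCoeff F x := by
  obtain ⟨f, rfl⟩ := Submodule.mkQ_surjective _ x
  rw [← map_smul, quotientCoeff_mk, quotientCoeff_mk, semigroupRingConst_smul,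
    HahnSeries.coeff_smul, smul_eq_mul]

/-- The image of an ideal of the semigroup ring in `K((t))`, as a `K`-subspace. -/
def idealSubspace (K : Type u) [Field K] (H : AddSubmonoid ℕ) {R : Type u} [CommRing R]
    [Algebra R (LaurentSeries K)] [IsSemigroupRing K H R] (I : Ideal R) :
    Submodule K (LaurentSeries K) where
  carrier := {f | ∃ r ∈ I, algebraMap R (LaurentSeries K) r = f}
  zero_mem' := ⟨0, I.zero_mem, map_zero _⟩
  add_mem' := by
    rintro _ _ ⟨r, hr, rfl⟩ ⟨s, hs, rfl⟩
    exact ⟨r + s, I.add_mem hr hs, map_add _ _ _⟩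
  smul_mem' := by
    rintro c _ ⟨r, hr, rfl⟩
    refine ⟨semigroupRingConst K H R c * r, I.mul_mem_left _ hr, ?_⟩
    rw [map_mul, ← Algebra.smul_def, semigroupRingConst_smul]

/-- `ψ` is an arbitrary `K`-linear extension from the image of `I`; only its values there matter,
since a nonzero ideal contains all series of large order. -/
theorem exists_linearMap_quotientCoeff (F : ℤ) (I : Ideal R)
    (g : I →ₗ[R] LaurentSeries K ⧸ monomialModule K R (isStable_canonicalSet H F)) :
    ∃ ψ : LaurentSeries K →ₗ[K] K, ∀ i : I,
      ψ (algebraMap R (LaurentSeries K) i) = quotientCoeff F (g i) := by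
  have hc : ∀ f : idealSubspace K H I, ∃ i : I, algebraMap R (LaurentSeries K) i = f := by
    rintro ⟨_, r, hr, rfl⟩
    exact ⟨⟨r, hr⟩, rfl⟩
  choose j hj using hc
  have hj' : ∀ (f : idealSubspace K H I) (i : I),
      algebraMap R (LaurentSeries K) i = f → j f = i := fun f i hi =>
    Subtype.ext (algebraMap_injective (K := K) H ((hj f).trans hi.symm))
  let ψ₀ : idealSubspace K H I →ₗ[K] K :=
    { toFun := fun f => quotientCoeff F (g (j f))
      map_add' := fun f f' => by
        rw [hj' (f + f') (j f + j f') (by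
          rw [Submodule.coe_add, map_add, hj, hj]; rfl), map_add, quotientCoeff_add]
      map_smul' := fun c f => by
        rw [hj' (c • f) (semigroupRingConst K H R c • j f) (by
          rw [Submodule.coe_smul, smul_eq_mul, map_mul, ← Algebra.smul_def,
            semigroupRingConst_smul, hj]; rfl), map_smul, quotientCoeff_smul]
        rfl }
  obtain ⟨ψ, hψ⟩ := LinearMap.exists_extend ψ₀
  refine ⟨ψ, fun i => ?_⟩
  have h1 := DFunLike.congr_fun hψ ⟨algebraMap R (LaurentSeries K) i, i, i.2, rfl⟩
  refine h1.trans ?_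
  change quotientCoeff F (g (j _)) = _
  rw [hj' _ i rfl]

/-- By orthogonality a class `y` in the quotient is determined by the form `r ↦ coeff F (r y)`. The
form `i ↦ coeff F (g i)` on `I` extends to a continuous form on `K((t))`, so it is pairing with some
`u`, and then `g` is multiplication by the class of `u`. -/
theorem baer_quotient_canonical {F : ℤ} (hF : ∀ n, F < n → ∃ h ∈ H, (h : ℤ) = n) :
    Module.Baer R (LaurentSeries K ⧸ monomialModule K R (isStable_canonicalSet H F)) := by
  intro I g
  by_cases hI : I = ⊥
  · subst hI
    refine ⟨0, fun x hx => ?_⟩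
    have h0 : (⟨x, hx⟩ : (⊥ : Ideal R)) = 0 := Subtype.ext hx
    rw [h0, map_zero, LinearMap.zero_apply]
  obtain ⟨i, hi, hi0⟩ := Submodule.exists_mem_ne_zero_of_ne_bot hI
  have hi' : algebraMap R (LaurentSeries K) i ≠ 0 := fun h =>
    hi0 (algebraMap_injective (K := K) H (by rw [h, map_zero]))
  obtain ⟨w, hw⟩ := Submodule.mkQ_surjective _ (g ⟨i, hi⟩)
  obtain ⟨b, hb⟩ := exists_lowerBound_coeff w
  obtain ⟨v, hv⟩ := exists_lowerBound_coeff (algebraMap R (LaurentSeries K) i)⁻¹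
  obtain ⟨ψ, hψ⟩ := exists_linearMap_quotientCoeff F I g
  -- Here `w` represents `g(i)` and has order at least `b`, while `i⁻¹` has order at least `v`. If
  -- `f` has order at least this `N`, then `s = f / i` has order at least `|F| + 1 + |b|`. So `s ∈
  -- R`, and `s * w` has order above `F`, whence `ψ f = 0`.
  obtain ⟨u, hu⟩ := exists_eq_coeff_mul F ψ (N := |F| + 1 + |b| - v) fun f hf => by
    have hs := lowerBound_coeff_mul hf hv
    obtain ⟨s, hs'⟩ := exists_algebraMap_eq (R := R) H
      (f := f * (algebraMap R (LaurentSeries K) i)⁻¹) fun n hn => hF n (by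
        have h1 := hs n hn
        have h2 := le_abs_self F
        have h3 := abs_nonneg b
        omega)
    have hf' : f = algebraMap R (LaurentSeries K) (s • (⟨i, hi⟩ : I) : I) := by
      rw [Submodule.coe_smul, smul_eq_mul, map_mul, hs', inv_mul_cancel_right₀ hi']
    rw [hf', hψ, map_smul, ← hw, ← map_smul, quotientCoeff_mk, Algebra.smul_def, hs']
    by_contra hne
    have h1 := lowerBound_coeff_mul hs hb F hne
    have h2 := le_abs_self F
    have h3 := neg_abs_le b
    omega
  refine ⟨LinearMap.toSpanSingleton R _
    ((monomialModule K R (isStable_canonicalSet H F)).mkQ u), fun x hx => ?_⟩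
  obtain ⟨y, hy⟩ := Submodule.mkQ_surjective _ (g ⟨x, hx⟩)
  rw [LinearMap.toSpanSingleton_apply, ← map_smul, ← hy]
  refine (Submodule.Quotient.eq _).mpr (mem_canonical_iff.mpr fun r => ?_)
  have h1 := hψ (r • ⟨x, hx⟩)
  rw [hu, map_smul, ← hy, ← map_smul, quotientCoeff_mk, Submodule.coe_smul, smul_eq_mul, map_mul,
    Algebra.smul_def] at h1
  rw [mul_sub, HahnSeries.coeff_sub, ← h1, Algebra.smul_def, sub_eq_zero]
  congr 1
  ring

/-- The socle of `K((t)) / N` is essential: multiplying by an element of `𝔪` raises the order, and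
series of order at least `c` lie in `N`, so the process of leaving the socle must stop. -/
theorem exists_smul_notMem_of_lowerBound (H : AddSubmonoid ℕ) [IsSemigroupRing K H R]
    [IsLocalRing R] {N : Submodule R (LaurentSeries K)} {c : ℤ}
    (hN : ∀ f : LaurentSeries K, (∀ n, f.coeff n ≠ 0 → c ≤ n) → f ∈ N) {x : LaurentSeries K}
    (hx : x ∉ N) : ∃ r : R, r • x ∉ N ∧ ∀ s ∈ maximalIdeal R, s • r • x ∈ N := by
  have key : ∀ (j : ℕ) (x : LaurentSeries K), (∀ n, x.coeff n ≠ 0 → c - j ≤ n) → x ∉ N →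
      ∃ r : R, r • x ∉ N ∧ ∀ s ∈ maximalIdeal R, s • r • x ∈ N := by
    intro j
    induction j with
    | zero => exact fun x hxc hx => absurd (hN x (by simpa using hxc)) hx
    | succ j ih =>
      intro x hxc hx
      by_cases h : ∀ s ∈ maximalIdeal R, s • x ∈ N
      · exact ⟨1, by rwa [one_smul], by rwa [one_smul]⟩
      · push Not at h
        obtain ⟨s, hs, hsx⟩ := h
        obtain ⟨r, hr, hr'⟩ := ih (s • x) (fun n hn => by
          obtain ⟨k, hk, hk', hn'⟩ := exists_of_coeff_smul_ne_zero H hn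
          have hk0 : k ≠ 0 := by
            rintro rfl
            exact hk' ((mem_maximalIdeal_iff_coeff_zero (K := K) H).mp hs)
          have := hxc _ hn'
          push_cast at this
          omega) hsx
        exact ⟨r * s, by rwa [mul_smul], by simpa only [mul_smul] using hr'⟩
  obtain ⟨M, hM⟩ := exists_lowerBound_coeff x
  exact key (c - M).toNat x (fun n hn => by
    have := hM n hn
    omega) hx

/-- Uniqueness of the canonical module up to a factor. A linear form that kills `N` but not a socle
generator `z` is `x ↦ coeff F (u * x)`, so `u N` is orthogonal to `R`. Conversely, if `u x` is
orthogonal to `R` but `x ∉ N`, some multiple of `x` is congruent to `z` modulo `N`, and the form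
would kill `z`. -/
theorem exists_mul_mem_canonical_iff [IsLocalRing R] (F : ℤ) {N : Submodule R (LaurentSeries K)}
    {c : ℤ} (hN : ∀ f : LaurentSeries K, (∀ n, f.coeff n ≠ 0 → c ≤ n) → f ∈ N)
    (hlen : Module.length R (Submodule.torsionBySet R (LaurentSeries K ⧸ N)
      (maximalIdeal R : Set R)) = 1) :
    ∃ u : LaurentSeries K, u ≠ 0 ∧
      ∀ x, x ∈ N ↔ u * x ∈ monomialModule K R (isStable_canonicalSet H F) := by
  have hsimple := Module.length_eq_one_iff.mp hlen
  have := IsSimpleModule.nontrivial R (Submodule.torsionBySet R (LaurentSeries K ⧸ N)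
      (maximalIdeal R : Set R))
  obtain ⟨⟨z', hz'⟩, hz0⟩ := exists_ne (0 : Submodule.torsionBySet R (LaurentSeries K ⧸ N)
      (maximalIdeal R : Set R))
  obtain ⟨z, rfl⟩ := Submodule.mkQ_surjective _ z'
  have hz : z ∉ N := fun h => hz0 (Subtype.ext ((Submodule.Quotient.mk_eq_zero _).mpr h))
  let NK : Submodule K (LaurentSeries K) :=
    { N.toAddSubmonoid with
      smul_mem' := fun c x hx => by
        rw [← semigroupRingConst_smul (H := H) (R := R)]
        exact N.smul_mem _ hx }
  obtain ⟨ψ, hψz, hψ⟩ := Submodule.exists_le_ker_of_notMem (p := NK) hz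
  obtain ⟨u, hu⟩ := exists_eq_coeff_mul F ψ fun f hf => hψ (hN f hf)
  refine ⟨u, fun h => hψz (by rw [hu, h, zero_mul, HahnSeries.coeff_zero]), fun x =>
    ⟨fun hx => mem_canonical_iff.mpr fun r => ?_, fun hx => ?_⟩⟩
  · rw [mul_left_comm, ← hu, ← Algebra.smul_def]
    exact hψ (N.smul_mem r hx)
  · by_contra hxN
    obtain ⟨r, hr, hr'⟩ := exists_smul_notMem_of_lowerBound H hN hxN
    let y : Submodule.torsionBySet R (LaurentSeries K ⧸ N) (maximalIdeal R : Set R) :=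
      ⟨N.mkQ (r • x), by
        rw [Submodule.mem_torsionBySet_iff]
        exact fun s => (Submodule.Quotient.mk_eq_zero _).mpr (hr' s s.2)⟩
    have hy : y ≠ 0 := fun h => hr ((Submodule.Quotient.mk_eq_zero _).mp (Subtype.ext_iff.mp h))
    obtain ⟨s, hs⟩ := IsSimpleModule.toSpanSingleton_surjective R hy ⟨N.mkQ z, hz'⟩
    have h1 : s • r • x - z ∈ N := (Submodule.Quotient.eq _).mp (Subtype.ext_iff.mp hs)
    have h2 : ψ (s • r • x - z) = 0 := hψ h1
    rw [map_sub, sub_eq_zero, ← mul_smul, hu, Algebra.smul_def, mul_left_comm,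
      mem_canonical_iff.mp hx] at h2
    exact hψz h2.symm

end CanonicalDuality

/-! ### Normalization, conductor, type and the trace of the canonical module. -/

section FarFlungGorenstein

open IsLocalRing IsSemigroupRing

universe u

theorem isFractionRing_laurentSeries (K : Type u) [Field K] (H : AddSubmonoid ℕ) (R : Type u)
    [CommRing R] [Algebra R (LaurentSeries K)] [IsSemigroupRing K H R] {F : ℤ}
    (hF : ∀ n, F < n → ∃ h ∈ H, (h : ℤ) = n) : IsFractionRing R (LaurentSeries K) where
  map_units y := by
    refine isUnit_iff_ne_zero.mpr fun h => ?_
    have hR : Nontrivial R := (algebraMap R (LaurentSeries K)).domain_nontrivial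
    refine nonZeroDivisors.ne_zero y.2 (algebraMap_injective (K := K) H ?_)
    rw [h, map_zero]
  surj f := by
    obtain ⟨N, hN⟩ := exists_lowerBound_coeff f
    -- This exponent exceeds `F`, and adding it to exponents at least `N` also gives exponents above
    -- `F`; so both `t ^ h` and `f * t ^ h` lie in `R`.
    obtain ⟨h, hh, hk⟩ := hF (|F| + 1 + |N|) (by
      have := le_abs_self F
      have := abs_nonneg N
      omega)
    obtain ⟨s, hs⟩ := exists_semigroupMonomial (K := K) (R := R) H hh
    obtain ⟨r, hr⟩ := exists_algebraMap_eq (R := R) H (f := f * HahnSeries.single (h : ℤ) 1)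
      fun n hn => hF n (by
        rw [HahnSeries.coeff_mul_single, mul_one] at hn
        have := hN _ hn
        have := le_abs_self F
        have := neg_abs_le N
        omega)
    refine ⟨⟨r, ⟨s, mem_nonZeroDivisors_iff_right.mpr fun x hx => ?_⟩⟩, ?_⟩
    · have h1 := congrArg (algebraMap R (LaurentSeries K)) hx
      rw [map_mul, map_zero, hs] at h1
      refine algebraMap_injective (K := K) H ?_
      rw [map_zero]
      exact (mul_eq_zero.mp h1).resolve_right (HahnSeries.single_ne_zero one_ne_zero)
    · exact (congrArg (f * ·) hs).trans hr.symm
  exists_of_eq {x y} h := ⟨1, by rw [algebraMap_injective (K := K) H h]⟩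

variable {K : Type u} [Field K] {H : AddSubmonoid ℕ} {R : Type u} [CommRing R]
  [Algebra R (LaurentSeries K)] [IsSemigroupRing K H R]

theorem isStable_nonneg : IsStable H {n : ℤ | 0 ≤ n} := by
  intro h _ a ha
  simp only [Set.mem_ofPred_eq] at ha ⊢
  omega

/-- `R` maps into `K[[t]]`, which is integrally closed in `K((t))`. -/
theorem nonneg_of_isIntegral (H : AddSubmonoid ℕ) [IsSemigroupRing K H R] {f : LaurentSeries K}
    (hf : IsIntegral R f) : ∀ n, f.coeff n ≠ 0 → 0 ≤ n := by
  let φ : R →+* (HahnSeries.ofPowerSeries ℤ K).range :=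
    (algebraMap R (LaurentSeries K)).codRestrict _ fun r =>
      ⟨PowerSeries.mk fun n => (algebraMap R (LaurentSeries K) r).coeff n, by
        ext n
        rw [PowerSeries.coeff_coe]
        split_ifs with h
        · by_contra hne
          obtain ⟨k, -, hk⟩ := exists_of_coeff_algebraMap_ne_zero H (Ne.symm hne)
          omega
        · rw [PowerSeries.coeff_mk]
          congr 1
          omega⟩
  let θ : PowerSeries K ≃+* (HahnSeries.ofPowerSeries ℤ K).range :=
    RingEquiv.ofBijective (HahnSeries.ofPowerSeries ℤ K).rangeRestrict
      ⟨fun _ _ h => HahnSeries.ofPowerSeries_injective (Subtype.ext_iff.mp h),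
        RingHom.rangeRestrict_surjective _⟩
  have hθ : ∀ x, HahnSeries.ofPowerSeries ℤ K (θ.symm x) = x := fun x =>
    congrArg Subtype.val (θ.apply_symm_apply x)
  have h1 : IsIntegral (PowerSeries K) f := by
    have := hf.map_of_comp_eq (θ.symm.toRingHom.comp φ) (RingHom.id (LaurentSeries K)) (by
      ext1 r
      exact (hθ (φ r)))
    exact this
  obtain ⟨g, rfl⟩ := IsIntegrallyClosed.isIntegral_iff.mp h1
  intro n hn
  rw [LaurentSeries.coe_algebraMap, PowerSeries.coeff_coe] at hn
  split_ifs at hn with h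
  · exact absurd rfl hn
  · omega

theorem monomialModule_fg {F : ℤ} (hF : ∀ n, F < n → ∃ h ∈ H, (h : ℤ) = n) {A : Set ℤ}
    (hA : IsStable H A) (hbdd : BddBelow A) : (monomialModule K R hA).FG := by
  obtain ⟨e, he, he0⟩ : ∃ e ∈ H, e ≠ 0 := by
    obtain ⟨e, he, hn⟩ := hF (|F| + 1) (by have := le_abs_self F; omega)
    exact ⟨e, he, by have := abs_nonneg F; omega⟩
  rw [monomialModule_eq_span _ hbdd he he0]
  exact Submodule.fg_span ((finite_stable_sub hA he he0).image _)

/-- The series of nonnegative order form a subring that is finitely generated as an `R`-module. -/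
theorem isIntegral_of_nonneg {F : ℤ} (hF : ∀ n, F < n → ∃ h ∈ H, (h : ℤ) = n)
    {f : LaurentSeries K} (hf : ∀ n, f.coeff n ≠ 0 → 0 ≤ n) : IsIntegral R f := by
  let S : Subalgebra R (LaurentSeries K) :=
    { monomialModule K R (isStable_nonneg (H := H)) with
      mul_mem' := fun {a b} ha hb => by
        exact lowerBound_coeff_mul (a := 0) (b := 0) ha hb
      algebraMap_mem' := fun r n hn => by
        obtain ⟨k, -, rfl⟩ := exists_of_coeff_algebraMap_ne_zero H hn
        exact Int.natCast_nonneg k }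
  have hfg : (monomialModule K R (isStable_nonneg (H := H))).FG :=
    monomialModule_fg hF _ ⟨0, fun _ h => h⟩
  exact IsIntegral.of_mem_of_fg S hfg f hf

variable (j : FractionRing R ≃ₐ[R] LaurentSeries K)

theorem mem_normalization_iff {F : ℤ} (hF : ∀ n, F < n → ∃ h ∈ H, (h : ℤ) = n)
    (x : FractionRing R) : x ∈ normalization R ↔ ∀ n, (j x).coeff n ≠ 0 → 0 ≤ n := by
  have h1 : x ∈ normalization R ↔ IsIntegral R (j x) :=
    (isIntegral_algEquiv j).symm
  rw [h1]
  exact ⟨nonneg_of_isIntegral H, isIntegral_of_nonneg hF⟩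

theorem normalization_fg (K : Type u) [Field K] {H : AddSubmonoid ℕ} (R : Type u)
    [CommRing R] [Algebra R (LaurentSeries K)] [IsSemigroupRing K H R]
    (j : FractionRing R ≃ₐ[R] LaurentSeries K) {F : ℤ} (hF : ∀ n, F < n → ∃ h ∈ H, (h : ℤ) = n) :
    (normalization R).FG := by
  have h : (normalization R).map j.toLinearMap = monomialModule K R (isStable_nonneg (H := H)) := by
    ext f
    constructor
    · rintro ⟨x, hx, rfl⟩
      exact (mem_normalization_iff j hF x).mp hx
    · intro hf
      exact ⟨j.symm f, (mem_normalization_iff j hF _).mpr (by rwa [j.apply_symm_apply]),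
        j.apply_symm_apply f⟩
  have hfg : ((normalization R).map j.toLinearMap).FG := by
    rw [h]
    exact monomialModule_fg hF _ ⟨0, fun _ h => h⟩
  exact Submodule.fg_of_fg_map_injective j.toLinearMap j.injective hfg

/-- If `x` had an exponent `n ≤ F`, multiplying by `t ^ (F - n)`, which is integral, would produce
an element of `R` with the exponent `F`. -/
theorem mem_one_div_normalization_iff {F : ℤ} (hF : ∀ n, F < n → ∃ h ∈ H, (h : ℤ) = n)
    (hF' : ¬∃ h ∈ H, (h : ℤ) = F) (x : FractionRing R) :
    x ∈ 1 / normalization R ↔ ∀ n, (j x).coeff n ≠ 0 → F < n := by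
  rw [Submodule.mem_div_iff_forall_mul_mem]
  constructor
  · intro h n hn
    by_contra! hnF
    obtain ⟨r, hr⟩ := Submodule.mem_one.mp (h (j.symm (HahnSeries.single (F - n) 1))
      ((mem_normalization_iff j hF _).mpr fun m hm => by
        rw [j.apply_symm_apply, HahnSeries.coeff_single] at hm
        split_ifs at hm with hmn
        · omega
        · exact absurd rfl hm))
    have h1 := congrArg (fun y => (j y).coeff F) hr
    simp only [AlgEquiv.commutes, map_mul, AlgEquiv.apply_symm_apply, HahnSeries.coeff_mul_single,
      mul_one, sub_sub_cancel] at h1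
    exact hF' (exists_of_coeff_algebraMap_ne_zero H (r := r) (h1 ▸ hn))
  · intro h y hy
    have h1 := (mem_normalization_iff j hF y).mp hy
    obtain ⟨r, hr⟩ := exists_algebraMap_eq (R := R) H (f := j (x * y)) fun n hn => hF n (by
      rw [map_mul] at hn
      have := lowerBound_coeff_mul (a := F + 1) (fun n hn => h n hn) h1 n hn
      omega)
    refine Submodule.mem_one.mpr ⟨r, j.injective ?_⟩
    rw [← hr, AlgEquiv.commutes]

theorem injective_laurentSeries (K : Type u) [Field K] (H : AddSubmonoid ℕ) (R : Type u)
    [CommRing R] [Algebra R (LaurentSeries K)] [IsSemigroupRing K H R] :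
    Module.Injective R (LaurentSeries K) :=
  (baer_laurentSeries (algebraMap_injective (K := K) H)).injective

variable [IsLocalRing R]

theorem eq_zero_of_maximalIdeal_smul_eq_zero {F : ℤ} (hF : ∀ n, F < n → ∃ h ∈ H, (h : ℤ) = n)
    (x : LaurentSeries K) (hx : ∀ r ∈ maximalIdeal R, r • x = 0) : x = 0 := by
  obtain ⟨e, he, hn⟩ := hF (|F| + 1) (by have := le_abs_self F; omega)
  obtain ⟨r, hr, hre⟩ := exists_mem_maximalIdeal_algebraMap_eq (K := K) (R := R) he
    (by have := abs_nonneg F; omega)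
  have h1 := hx r hr
  rw [Algebra.smul_def, hre] at h1
  exact (mul_eq_zero.mp h1).resolve_left (HahnSeries.single_ne_zero one_ne_zero)

theorem length_residueExt_one_eq {F : ℤ} (hF : ∀ n, F < n → ∃ h ∈ H, (h : ℤ) = n) {M : Type u}
    [AddCommGroup M] [Module R M] (ι : M →ₗ[R] LaurentSeries K) (hι : Function.Injective ι) :
    Module.length R (ResidueExt R M 1) = Module.length R (Submodule.torsionBySet R
      (LaurentSeries K ⧸ LinearMap.range ι) (maximalIdeal R : Set R)) :=
  have := injective_laurentSeries K H R
  length_residueExt_one ι hι (eq_zero_of_maximalIdeal_smul_eq_zero hF)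

theorem cohenMacaulayType_eq_ncard (K : Type u) [Field K] {H : AddSubmonoid ℕ} (R : Type u)
    [CommRing R] [Algebra R (LaurentSeries K)] [IsSemigroupRing K H R] [IsLocalRing R]
    {F : ℤ} (hF : ∀ n, F < n → ∃ h ∈ H, (h : ℤ) = n)
    (hfin : (socleSet H {n : ℤ | ∃ h ∈ H, (h : ℤ) = n} \ {n : ℤ | ∃ h ∈ H, (h : ℤ) = n}).Finite) :
    cohenMacaulayType R =
      (socleSet H {n : ℤ | ∃ h ∈ H, (h : ℤ) = n} \ {n : ℤ | ∃ h ∈ H, (h : ℤ) = n}).ncard :=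
  (length_residueExt_one_eq hF (Algebra.linearMap R (LaurentSeries K))
    (algebraMap_injective (K := K) H)).trans
    (length_torsion_quotient (isStable_range H) hfin (range_linearMap_eq_monomialModule H))

/-- `K((t))` and its quotient by the canonical module are injective, so `Ext^i` vanishes for `i ≥
2`; the socle of the quotient is the line spanned by `t ^ F`. -/
theorem isCanonicalModule_of_range_eq {F : ℤ} (hF : ∀ n, F < n → ∃ h ∈ H, (h : ℤ) = n)
    {M : Type u} [AddCommGroup M] [Module R M] (ι : M →ₗ[R] LaurentSeries K)
    (hι : Function.Injective ι)
    (hr : LinearMap.range ι = monomialModule K R (isStable_canonicalSet H F)) :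
    IsCanonicalModule R M := by
  have hsocle : socleSet H (canonicalSet H F) \ canonicalSet H F = {F} := by
    ext n
    constructor
    · rintro ⟨h1, h2⟩
      obtain ⟨h, hh, hn⟩ := not_not.mp h2
      by_cases h0 : h = 0
      · subst h0
        simp only [Set.mem_singleton_iff]
        push_cast at hn
        omega
      · exact absurd ⟨0, H.zero_mem, by push_cast; omega⟩ (h1 h hh h0)
    · rintro rfl
      refine ⟨fun h hh h0 => ?_, fun h => h ⟨0, H.zero_mem, by simp⟩⟩
      rintro ⟨k, -, hk⟩
      omega
  have hinj := injective_laurentSeries K H R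
  have hinj' : Module.Injective R (LaurentSeries K ⧸ LinearMap.range ι) := by
    rw [hr]
    exact (baer_quotient_canonical hF).injective
  refine ⟨?_, fun i => ?_⟩
  · have hfg : (LinearMap.range ι).FG := by
      rw [hr]
      refine monomialModule_fg hF _ ⟨0, fun n hn => ?_⟩
      by_contra! h
      exact hn (hF _ (by omega))
    have : Module.Finite R (LinearMap.range ι) := Module.Finite.iff_fg.mpr hfg
    exact Module.Finite.equiv (LinearEquiv.ofInjective ι hι).symm
  · match i with
    | 0 =>
      refine length_residueExt_zero fun x hx => hι ?_
      rw [map_zero]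
      refine eq_zero_of_maximalIdeal_smul_eq_zero (R := R) hF _ fun r hrm => ?_
      rw [← map_smul, hx r hrm, map_zero]
    | 1 =>
      rw [length_residueExt_one_eq hF ι hι, length_torsion_quotient _ _ hr, hsocle]
      · simp
      · rw [hsocle]
        exact Set.finite_singleton F
    | i + 2 => exact length_residueExt_add_two ι hι i

/-- Multiplication by `t ^ k` sends the canonical exponents into `H` iff `F - k` is not a sum of two
of them. The trace condition says that this happens only for `k > F`. -/
theorem isFarFlungGorenstein_iff (K : Type u) [Field K] {H : AddSubmonoid ℕ} (R : Type u)
    [CommRing R] [Algebra R (LaurentSeries K)] [IsSemigroupRing K H R] [IsLocalRing R]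
    {F : ℤ} (hF : ∀ n, F < n → ∃ h ∈ H, (h : ℤ) = n)
    (hF' : ¬∃ h ∈ H, (h : ℤ) = F) : IsFarFlungGorenstein R ↔
      ∀ n : ℤ, 0 ≤ n → ∃ a ∈ canonicalSet H F, ∃ b ∈ canonicalSet H F, a + b = n := by
  have hfrac := isFractionRing_laurentSeries K H R hF
  let j : FractionRing R ≃ₐ[R] LaurentSeries K := FractionRing.algEquiv R (LaurentSeries K)
  have h0 : (0 : ℤ) ∈ canonicalSet H F := by simpa [canonicalSet] using hF'
  constructor
  · rintro ⟨-, C, hC1, -, ⟨-, hC⟩, htr⟩ n hn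
    by_contra! hne
    let ι : C →ₗ[R] LaurentSeries K := j.toLinearMap.comp C.subtype
    have hι : Function.Injective ι := j.injective.comp C.injective_subtype
    have hlen := (length_residueExt_one_eq hF ι hι).symm.trans (hC 1)
    -- The given `C` is known only through its Ext groups; it contains `R`, hence every series of
    -- order above `F`, so the uniqueness statement identifies it up to the factor `u`.
    obtain ⟨u, hu0, hu⟩ := exists_mul_mem_canonical_iff (H := H) F (c := F + 1) (fun f hf => by
      obtain ⟨r, rfl⟩ := exists_algebraMap_eq (R := R) H (f := f) fun n hn => hF n (by
        have := hf n hn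
        omega)
      exact ⟨⟨algebraMap R _ r, hC1 (Submodule.mem_one.mpr ⟨r, rfl⟩)⟩, j.commutes r⟩) hlen
    have hmem : ∀ y : C, HahnSeries.single (F - n) 1 * (u * ι y) ∈
        monomialModule K R (isStable_range H) := fun y m hm => by
      rw [HahnSeries.coeff_single_mul, one_mul] at hm
      have h1 := (hu (ι y)).mp ⟨y, rfl⟩ _ hm
      by_contra h2
      exact hne _ h1 (F - m) (by simpa [canonicalSet] using h2) (by ring)
    let g : C →ₗ[R] R := (monomialModuleEquiv K H R).symm.toLinearMap.comp
      ((((LinearMap.mulLeft R (HahnSeries.single (F - n) 1)).comp (LinearMap.mulLeft R u)).comp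
        ι).codRestrict _ hmem)
    have hg : ∀ y, algebraMap R (LaurentSeries K) (g y) =
        HahnSeries.single (F - n) 1 * (u * ι y) := fun y =>
      algebraMap_monomialModuleEquiv_symm H _
    -- As `0` is a canonical exponent, `u⁻¹` lies in `C`, and its image under `g` is `t ^ (F - n)`.
    -- This trace element lies outside the conductor because `n ≥ 0`.
    obtain ⟨y, hy⟩ := (hu u⁻¹).mpr (by
      rw [mul_inv_cancel₀ hu0, ← HahnSeries.single_zero_one]
      exact single_mem_monomialModule h0 1)
    have h1 : algebraMap R (FractionRing R) (g y) ∈ 1 / normalization R := by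
      rw [← htr]
      exact ⟨g y, (le_iSup (fun f : C →ₗ[R] R => LinearMap.range f) g) ⟨y, rfl⟩, rfl⟩
    have h2 := (mem_one_div_normalization_iff j hF hF' _).mp h1 (F - n)
    rw [j.commutes, hg, hy, mul_inv_cancel₀ hu0, mul_one, HahnSeries.coeff_single_same] at h2
    have := h2 one_ne_zero
    omega
  · intro hsum
    let C : Submodule R (FractionRing R) :=
      (monomialModule K R (isStable_canonicalSet H F)).comap j.toLinearMap
    have hC : ∀ x, x ∈ C ↔ j x ∈ monomialModule K R (isStable_canonicalSet H F) := fun x => Iff.rfl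
    have hCpos : ∀ x ∈ C, ∀ n, (j x).coeff n ≠ 0 → 0 ≤ n := by
      intro x hx n hn
      by_contra! h
      exact (hC x).mp hx n hn (hF _ (by omega))
    let ι : C →ₗ[R] LaurentSeries K := j.toLinearMap.comp C.subtype
    have hι : Function.Injective ι := j.injective.comp C.injective_subtype
    have h1C : (1 : FractionRing R) ∈ C := by
      rw [hC, map_one, ← HahnSeries.single_zero_one]
      exact single_mem_monomialModule h0 1
    refine ⟨normalization_fg K R j hF, C, Submodule.one_le.mpr h1C, fun x hx =>
      (mem_normalization_iff j hF x).mpr (hCpos x hx), isCanonicalModule_of_range_eq hF ι hι ?_, ?_⟩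
    · ext f
      constructor
      · rintro ⟨y, rfl⟩
        exact y.2
      · intro hf
        exact ⟨⟨j.symm f, by rwa [hC, j.apply_symm_apply]⟩,
          j.apply_symm_apply f⟩
    · refine le_antisymm ?_ fun x hx => ?_
      · rw [Submodule.map_le_iff_le_comap]
        refine iSup_le fun f => ?_
        -- Every homomorphism from a fractional ideal containing `1` is multiplication by its value
        -- at `1`.
        have hfy : ∀ y, algebraMap R (FractionRing R) (f y) =
            algebraMap R (FractionRing R) (f ⟨1, h1C⟩) * y := by
          intro y
          obtain ⟨⟨a, b⟩, hab⟩ := IsLocalization.surj (nonZeroDivisors R) (y : FractionRing R)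
          have h1 : (b : R) • y = a • (⟨1, h1C⟩ : C) := Subtype.ext (by
            rw [Submodule.coe_smul, Submodule.coe_smul, Algebra.smul_def, Algebra.smul_def, mul_one,
              mul_comm]
            exact hab)
          have h2 := congrArg (fun z => algebraMap R (FractionRing R) (f z)) h1
          simp only [map_smul, smul_eq_mul, map_mul] at h2
          refine (IsLocalization.map_units (FractionRing R) b).mul_left_cancel ?_
          rw [h2, ← hab]
          ring
        have hf1 : ∀ n, (algebraMap R (LaurentSeries K) (f ⟨1, h1C⟩)).coeff n ≠ 0 → F < n := by
          intro n hn
          by_contra! hnF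
          -- If `f 1` had the exponent `n ≤ F`, then `f (t ^ a)` would have the exponent `n + a = F
          -- - b`, which is not in `H`.
          obtain ⟨a, ha, b, hb, hab⟩ := hsum (F - n) (by omega)
          have haC : j.symm (HahnSeries.single a 1) ∈ C := by
            rw [hC, j.apply_symm_apply]
            exact single_mem_monomialModule ha 1
          have h1 := congrArg (fun z => (j z).coeff (n + a))
            (hfy ⟨j.symm (HahnSeries.single a 1), haC⟩)
          simp only [AlgEquiv.commutes, map_mul, AlgEquiv.apply_symm_apply,
            HahnSeries.coeff_mul_single, mul_one, add_sub_cancel_right] at h1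
          obtain ⟨h, hh, hk⟩ := exists_of_coeff_algebraMap_ne_zero H (h1 ▸ hn)
          exact hb ⟨h, hh, by omega⟩
        rintro _ ⟨y, rfl⟩
        refine (mem_one_div_normalization_iff j hF hF' _).mpr fun n hn => ?_
        rw [Algebra.linearMap_apply, hfy, map_mul, j.commutes] at hn
        have := lowerBound_coeff_mul (a := F + 1) (fun n hn => hf1 n hn) (hCpos y y.2) n hn
        omega
      · have hx' := (mem_one_div_normalization_iff j hF hF' x).mp hx
        have hmem : ∀ y : C, j x * ι y ∈ monomialModule K R (isStable_range H) := fun y n hn =>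
          hF n (by
            have := lowerBound_coeff_mul (a := F + 1) (fun n hn => hx' n hn) (hCpos y y.2) n hn
            omega)
        let g : C →ₗ[R] R := (monomialModuleEquiv K H R).symm.toLinearMap.comp
          (((LinearMap.mulLeft R (j x)).comp ι).codRestrict _ hmem)
        have hg : algebraMap R (LaurentSeries K) (g ⟨1, h1C⟩) = j x * j 1 :=
          algebraMap_monomialModuleEquiv_symm H _
        refine ⟨g ⟨1, h1C⟩, (le_iSup (fun f : C →ₗ[R] R => LinearMap.range f) g) ⟨_, rfl⟩,
          j.injective ?_⟩
        rw [Algebra.linearMap_apply, j.commutes, hg, map_one, mul_one]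

end FarFlungGorenstein

/-! ### The four families and their Apéry sets. -/

section NumericalSemigroup

/-- Membership in the semigroup of multiplicity `5` with Apéry set `{0, w₁, w₂, w₃, w₄}`. -/
def AperyMem (w₁ w₂ w₃ w₄ n : ℕ) : Prop :=
  n % 5 = 0 ∨ (n % 5 = 1 ∧ w₁ ≤ n) ∨ (n % 5 = 2 ∧ w₂ ≤ n) ∨ (n % 5 = 3 ∧ w₃ ≤ n) ∨
    (n % 5 = 4 ∧ w₄ ≤ n)

/-- The Apéry sets of the far-flung Gorenstein semigroups of type `3`, together with their
Frobenius numbers `F`. -/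
def FarFlungShape (m w₁ w₂ w₃ w₄ : ℕ) (F : ℤ) : Prop :=
  (w₄ = 5 * m + 4 ∧ w₁ = 10 * m + 6 ∧ w₂ = 10 * m + 7 ∧ w₃ = 10 * m + 8 ∧ F = 10 * m + 3) ∨
  (w₁ = 5 * m + 1 ∧ w₂ = 10 * m + 2 ∧ w₃ = 10 * m + 3 ∧ w₄ = 10 * m + 4 ∧ F = 10 * m - 1) ∨
  (w₂ = 5 * m + 2 ∧ w₁ = 10 * m + 1 ∧ w₃ = 10 * m + 3 ∧ w₄ = 10 * m + 4 ∧ F = 10 * m - 1) ∨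
  (w₃ = 5 * m + 3 ∧ w₁ = 10 * m + 6 ∧ w₂ = 10 * m + 7 ∧ w₄ = 10 * m + 4 ∧ F = 10 * m + 2)

/-- The hypotheses are `w_(i+j) ≤ w_i + w_j` for the pairs with `i + j` not divisible by 5; the
other pairs need no condition. -/
theorem AperyMem.add {w₁ w₂ w₃ w₄ : ℕ} (h11 : w₂ ≤ w₁ + w₁) (h12 : w₃ ≤ w₁ + w₂)
    (h13 : w₄ ≤ w₁ + w₃) (h22 : w₄ ≤ w₂ + w₂) (h24 : w₁ ≤ w₂ + w₄) (h33 : w₁ ≤ w₃ + w₃)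
    (h34 : w₂ ≤ w₃ + w₄) (h44 : w₃ ≤ w₄ + w₄) {p q : ℕ} (hp : AperyMem w₁ w₂ w₃ w₄ p)
    (hq : AperyMem w₁ w₂ w₃ w₄ q) : AperyMem w₁ w₂ w₃ w₄ (p + q) := by
  unfold AperyMem at *
  rw [Nat.add_mod]
  rcases hp with hp | ⟨hp, hp'⟩ | ⟨hp, hp'⟩ | ⟨hp, hp'⟩ | ⟨hp, hp'⟩ <;>
  rcases hq with hq | ⟨hq, hq'⟩ | ⟨hq, hq'⟩ | ⟨hq, hq'⟩ | ⟨hq, hq'⟩ <;>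
  rw [hp, hq] <;> simp <;> omega

theorem FarFlungShape.add {m w₁ w₂ w₃ w₄ : ℕ} {F : ℤ} (h : FarFlungShape m w₁ w₂ w₃ w₄ F) {p q : ℕ}
    (hp : AperyMem w₁ w₂ w₃ w₄ p) (hq : AperyMem w₁ w₂ w₃ w₄ q) :
    AperyMem w₁ w₂ w₃ w₄ (p + q) := by
  unfold FarFlungShape at h
  refine AperyMem.add ?_ ?_ ?_ ?_ ?_ ?_ ?_ ?_ hp hq <;> omega

theorem mem_of_mod_five {S : AddSubmonoid ℕ} (h5 : 5 ∈ S) {w n : ℕ} (hw : w ∈ S)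
    (hmod : n % 5 = w % 5) (hle : w ≤ n) : n ∈ S := by
  have h : n = w + (n - w) / 5 * 5 := by omega
  rw [h]
  exact S.add_mem hw (by simpa using S.nsmul_mem h5 ((n - w) / 5))

/-- The last hypothesis allows the Apéry element `2x` to be absent from the generators. This is why
four generators suffice in multiplicity 5. -/
theorem mem_closure_iff_aperyMem {m x c d w₁ w₂ w₃ w₄ : ℕ} {F : ℤ}
    (hshape : FarFlungShape m w₁ w₂ w₃ w₄ F)
    (hx : AperyMem w₁ w₂ w₃ w₄ x) (hc : AperyMem w₁ w₂ w₃ w₄ c) (hd : AperyMem w₁ w₂ w₃ w₄ d)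
    (h : ∀ n, AperyMem w₁ w₂ w₃ w₄ n → (n % 5 = 0 ∨ (n % 5 = x % 5 ∧ x ≤ n) ∨
      (n % 5 = (x + x) % 5 ∧ x + x ≤ n) ∨ (n % 5 = c % 5 ∧ c ≤ n) ∨ (n % 5 = d % 5 ∧ d ≤ n)))
    (n : ℕ) : n ∈ AddSubmonoid.closure {5, x, c, d} ↔ AperyMem w₁ w₂ w₃ w₄ n := by
  constructor
  · intro hn
    induction hn using AddSubmonoid.closure_induction with
    | mem n hn =>
      rcases hn with rfl | rfl | rfl | rfl
      · exact Or.inl rfl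
      · exact hx
      · exact hc
      · exact hd
    | zero => exact Or.inl rfl
    | add p q _ _ hp hq => exact hshape.add hp hq
  · intro hn
    have h5 : 5 ∈ AddSubmonoid.closure {5, x, c, d} := AddSubmonoid.subset_closure (by simp)
    have hxm : x ∈ AddSubmonoid.closure {5, x, c, d} := AddSubmonoid.subset_closure (by simp)
    rcases h n hn with h | ⟨h, h'⟩ | ⟨h, h'⟩ | ⟨h, h'⟩ | ⟨h, h'⟩
    · exact mem_of_mod_five h5 (zero_mem _) h (Nat.zero_le _)
    · exact mem_of_mod_five h5 hxm h h'
    · exact mem_of_mod_five h5 (add_mem hxm hxm) h h'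
    · exact mem_of_mod_five h5 (AddSubmonoid.subset_closure (by simp)) h h'
    · exact mem_of_mod_five h5 (AddSubmonoid.subset_closure (by simp)) h h'

theorem exists_eq_closure_iff (H : AddSubmonoid ℕ) :
    (∃ m : ℕ, 1 ≤ m ∧
      (H = AddSubmonoid.closure {5, 5 * m + 4, 10 * m + 6, 10 * m + 7} ∨
       H = AddSubmonoid.closure {5, 5 * m + 1, 10 * m + 3, 10 * m + 4} ∨
       H = AddSubmonoid.closure {5, 5 * m + 2, 10 * m + 1, 10 * m + 3} ∨
       H = AddSubmonoid.closure {5, 5 * m + 3, 10 * m + 4, 10 * m + 7})) ↔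
    ∃ (m w₁ w₂ w₃ w₄ : ℕ) (F : ℤ), 1 ≤ m ∧ FarFlungShape m w₁ w₂ w₃ w₄ F ∧
      ∀ n, n ∈ H ↔ AperyMem w₁ w₂ w₃ w₄ n := by
  have s1 : ∀ m : ℕ, FarFlungShape m (10 * m + 6) (10 * m + 7) (10 * m + 8) (5 * m + 4)
      (10 * m + 3) := fun m => Or.inl ⟨rfl, rfl, rfl, rfl, rfl⟩
  have s2 : ∀ m : ℕ, FarFlungShape m (5 * m + 1) (10 * m + 2) (10 * m + 3) (10 * m + 4)
      (10 * m - 1) := fun m => Or.inr (Or.inl ⟨rfl, rfl, rfl, rfl, rfl⟩)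
  have s3 : ∀ m : ℕ, FarFlungShape m (10 * m + 1) (5 * m + 2) (10 * m + 3) (10 * m + 4)
      (10 * m - 1) := fun m => Or.inr (Or.inr (Or.inl ⟨rfl, rfl, rfl, rfl, rfl⟩))
  have s4 : ∀ m : ℕ, FarFlungShape m (10 * m + 6) (10 * m + 7) (5 * m + 3) (10 * m + 4)
      (10 * m + 2) := fun m => Or.inr (Or.inr (Or.inr ⟨rfl, rfl, rfl, rfl, rfl⟩))
  have h1 : ∀ m n : ℕ, n ∈ AddSubmonoid.closure {5, 5 * m + 4, 10 * m + 6, 10 * m + 7} ↔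
      AperyMem (10 * m + 6) (10 * m + 7) (10 * m + 8) (5 * m + 4) n := fun m n => by
    refine mem_closure_iff_aperyMem (s1 m) ?_ ?_ ?_ ?_ n <;> unfold AperyMem <;> omega
  have h2 : ∀ m n : ℕ, n ∈ AddSubmonoid.closure {5, 5 * m + 1, 10 * m + 3, 10 * m + 4} ↔
      AperyMem (5 * m + 1) (10 * m + 2) (10 * m + 3) (10 * m + 4) n := fun m n => by
    refine mem_closure_iff_aperyMem (s2 m) ?_ ?_ ?_ ?_ n <;> unfold AperyMem <;> omega
  have h3 : ∀ m n : ℕ, n ∈ AddSubmonoid.closure {5, 5 * m + 2, 10 * m + 1, 10 * m + 3} ↔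
      AperyMem (10 * m + 1) (5 * m + 2) (10 * m + 3) (10 * m + 4) n := fun m n => by
    refine mem_closure_iff_aperyMem (s3 m) ?_ ?_ ?_ ?_ n <;> unfold AperyMem <;> omega
  have h4 : ∀ m n : ℕ, n ∈ AddSubmonoid.closure {5, 5 * m + 3, 10 * m + 4, 10 * m + 7} ↔
      AperyMem (10 * m + 6) (10 * m + 7) (5 * m + 3) (10 * m + 4) n := fun m n => by
    refine mem_closure_iff_aperyMem (s4 m) ?_ ?_ ?_ ?_ n <;> unfold AperyMem <;> omega
  constructor
  · rintro ⟨m, hm, rfl | rfl | rfl | rfl⟩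
    · exact ⟨m, _, _, _, _, _, hm, s1 m, h1 m⟩
    · exact ⟨m, _, _, _, _, _, hm, s2 m, h2 m⟩
    · exact ⟨m, _, _, _, _, _, hm, s3 m, h3 m⟩
    · exact ⟨m, _, _, _, _, _, hm, s4 m, h4 m⟩
  · rintro ⟨m, w₁, w₂, w₃, w₄, F, hm, hs, h⟩
    refine ⟨m, hm, ?_⟩
    rcases hs with ⟨rfl, rfl, rfl, rfl, -⟩ | ⟨rfl, rfl, rfl, rfl, -⟩ | ⟨rfl, rfl, rfl, rfl, -⟩ |
      ⟨rfl, rfl, rfl, rfl, -⟩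
    · exact Or.inl (AddSubmonoid.ext fun n => (h n).trans (h1 m n).symm)
    · exact Or.inr (Or.inl (AddSubmonoid.ext fun n => (h n).trans (h2 m n).symm))
    · exact Or.inr (Or.inr (Or.inl (AddSubmonoid.ext fun n => (h n).trans (h3 m n).symm)))
    · exact Or.inr (Or.inr (Or.inr (AddSubmonoid.ext fun n => (h n).trans (h4 m n).symm)))

/-- The pseudo-Frobenius numbers of `H`. -/
abbrev pseudoFrobenius (H : AddSubmonoid ℕ) : Set ℤ :=
  socleSet H {n : ℤ | ∃ h ∈ H, (h : ℤ) = n} \ {n : ℤ | ∃ h ∈ H, (h : ℤ) = n}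

variable {H : AddSubmonoid ℕ} {m w₁ w₂ w₃ w₄ : ℕ} {F : ℤ}

theorem FarFlungShape.frobenius (hm : 1 ≤ m) (hs : FarFlungShape m w₁ w₂ w₃ w₄ F)
    (h : ∀ n, n ∈ H ↔ AperyMem w₁ w₂ w₃ w₄ n) :
    (∀ n, F < n → ∃ h ∈ H, (h : ℤ) = n) ∧ ¬∃ h ∈ H, (h : ℤ) = F := by
  unfold FarFlungShape at hs
  constructor
  · intro n hn
    refine ⟨n.toNat, (h _).mpr ?_, by omega⟩
    unfold AperyMem
    omega
  · rintro ⟨k, hk, hkF⟩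
    rw [h] at hk
    unfold AperyMem at hk
    omega

theorem FarFlungShape.isLeast (hm : 1 ≤ m) (hs : FarFlungShape m w₁ w₂ w₃ w₄ F)
    (h : ∀ n, n ∈ H ↔ AperyMem w₁ w₂ w₃ w₄ n) : IsLeast {h ∈ H | h ≠ 0} 5 := by
  refine ⟨⟨(h 5).mpr (Or.inl rfl), by omega⟩, fun n hn => ?_⟩
  obtain ⟨hn, hn0⟩ := hn
  rw [h] at hn
  unfold AperyMem at hn
  unfold FarFlungShape at hs
  omega

theorem exists_mem_iff_aperyMem (h : ∀ n, n ∈ H ↔ AperyMem w₁ w₂ w₃ w₄ n) (n : ℤ) :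
    (∃ k ∈ H, (k : ℤ) = n) ↔ 0 ≤ n ∧ AperyMem w₁ w₂ w₃ w₄ n.toNat := by
  constructor
  · rintro ⟨k, hk, rfl⟩
    exact ⟨by omega, by simpa using (h k).mp hk⟩
  · rintro ⟨h0, hn⟩
    exact ⟨n.toNat, (h _).mpr hn, by omega⟩

/-- The set is `{F, F - 1, F - b}` with `b ∈ {2, 3}`. A gap above `F - 5` is pseudo-Frobenius since
nonzero elements of `H` are at least 5. Conversely, adding 5 leaves only the numbers `w - 5` with
`w` an Apéry element, and adding the generator `x` near `5m` excludes `-5` and `x - 5`. -/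
theorem FarFlungShape.ncard_pseudoFrobenius (hm : 1 ≤ m) (hs : FarFlungShape m w₁ w₂ w₃ w₄ F)
    (h : ∀ n, n ∈ H ↔ AperyMem w₁ w₂ w₃ w₄ n) : (pseudoFrobenius H).ncard = 3 := by
  obtain ⟨hF, -⟩ := hs.frobenius hm h
  have hleast := (hs.isLeast hm h).2
  have hmem := exists_mem_iff_aperyMem h
  obtain ⟨b, hb, hb'⟩ : ∃ b : ℤ, (b = 2 ∨ b = 3) ∧ ∀ n, n ∈ pseudoFrobenius H ↔
      (n = F ∨ n = F - 1 ∨ n = F - b) := by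
    have hle : ∀ k ∈ H, k ≠ 0 → 5 ≤ k := fun k hk hk0 => hleast ⟨hk, hk0⟩
    suffices ∃ b : ℤ, (b = 2 ∨ b = 3) ∧ (¬∃ k ∈ H, (k : ℤ) = F) ∧ (¬∃ k ∈ H, (k : ℤ) = F - 1) ∧
        (¬∃ k ∈ H, (k : ℤ) = F - b) ∧ ∀ n ∈ pseudoFrobenius H, n = F ∨ n = F - 1 ∨ n = F - b by
      obtain ⟨b, hb, h0, h1, h2, h3⟩ := this
      refine ⟨b, hb, fun n => ⟨h3 n, fun hn => ⟨fun k hk hk0 => hF _ ?_, ?_⟩⟩⟩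
      · have := hle k hk hk0
        omega
      · rcases hn with rfl | rfl | rfl
        exacts [h0, h1, h2]
    rcases hs with ⟨rfl, rfl, rfl, rfl, rfl⟩ | ⟨rfl, rfl, rfl, rfl, rfl⟩ |
      ⟨rfl, rfl, rfl, rfl, rfl⟩ | ⟨rfl, rfl, rfl, rfl, rfl⟩
    · refine ⟨2, Or.inl rfl, ?_, ?_, ?_, fun n hn => ?_⟩
      iterate 3 (rw [hmem]; unfold AperyMem; omega)
      have h1 := hn.1 5 ((h _).mpr (by unfold AperyMem; omega)) (by omega)
      have h2 := hn.1 (5 * m + 4) ((h _).mpr (by unfold AperyMem; omega)) (by omega)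
      have h3 := hn.2
      rw [Set.mem_ofPred_eq, hmem] at h1 h2 h3
      unfold AperyMem at h1 h2 h3
      omega
    · refine ⟨2, Or.inl rfl, ?_, ?_, ?_, fun n hn => ?_⟩
      iterate 3 (rw [hmem]; unfold AperyMem; omega)
      have h1 := hn.1 5 ((h _).mpr (by unfold AperyMem; omega)) (by omega)
      have h2 := hn.1 (5 * m + 1) ((h _).mpr (by unfold AperyMem; omega)) (by omega)
      have h3 := hn.2
      rw [Set.mem_ofPred_eq, hmem] at h1 h2 h3
      unfold AperyMem at h1 h2 h3
      omega
    · refine ⟨3, Or.inr rfl, ?_, ?_, ?_, fun n hn => ?_⟩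
      iterate 3 (rw [hmem]; unfold AperyMem; omega)
      have h1 := hn.1 5 ((h _).mpr (by unfold AperyMem; omega)) (by omega)
      have h2 := hn.1 (5 * m + 2) ((h _).mpr (by unfold AperyMem; omega)) (by omega)
      have h3 := hn.2
      rw [Set.mem_ofPred_eq, hmem] at h1 h2 h3
      unfold AperyMem at h1 h2 h3
      omega
    · refine ⟨3, Or.inr rfl, ?_, ?_, ?_, fun n hn => ?_⟩
      iterate 3 (rw [hmem]; unfold AperyMem; omega)
      have h1 := hn.1 5 ((h _).mpr (by unfold AperyMem; omega)) (by omega)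
      have h2 := hn.1 (5 * m + 3) ((h _).mpr (by unfold AperyMem; omega)) (by omega)
      have h3 := hn.2
      rw [Set.mem_ofPred_eq, hmem] at h1 h2 h3
      unfold AperyMem at h1 h2 h3
      omega
  rw [Set.ncard_eq_three]
  exact ⟨F, F - 1, F - b, by omega, by omega, by omega, Set.ext fun n => by simp [hb']⟩

/-- A minimal generator other than 5 is a nonzero Apéry element, and one of those four is `x + x`.
-/
theorem FarFlungShape.ncard_minimalGenerators_lt (hm : 1 ≤ m) (hs : FarFlungShape m w₁ w₂ w₃ w₄ F)
    (h : ∀ n, n ∈ H ↔ AperyMem w₁ w₂ w₃ w₄ n) : (minimalGenerators H).ncard < 5 := by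
  obtain ⟨x, y, z, hx⟩ : ∃ x y z : ℕ, ∀ n ∈ minimalGenerators H,
      n = 5 ∨ n = x ∨ n = y ∨ n = z := by
    have key : ∀ n ∈ minimalGenerators H, AperyMem w₁ w₂ w₃ w₄ n ∧ n ≠ 0 ∧
        (AperyMem w₁ w₂ w₃ w₄ (n - 5) → n ≤ 5) := fun n hn => by
      refine ⟨(h n).mp hn.1, hn.2.1, fun h5 => ?_⟩
      by_contra hlt
      exact hn.2.2 5 ((h 5).mpr (Or.inl rfl)) (n - 5) ((h _).mpr h5) (by omega) (by omega)
        (by omega)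
    rcases hs with ⟨rfl, rfl, rfl, rfl, rfl⟩ | ⟨rfl, rfl, rfl, rfl, rfl⟩ |
      ⟨rfl, rfl, rfl, rfl, rfl⟩ | ⟨rfl, rfl, rfl, rfl, rfl⟩
    · refine ⟨5 * m + 4, 10 * m + 6, 10 * m + 7, fun n hn => ?_⟩
      have hx := (h (5 * m + 4)).mpr (by unfold AperyMem; omega)
      have h1 := hn.2.2 _ hx _ hx (by omega) (by omega)
      have h2 := key n hn
      unfold AperyMem at h2
      omega
    · refine ⟨5 * m + 1, 10 * m + 3, 10 * m + 4, fun n hn => ?_⟩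
      have hx := (h (5 * m + 1)).mpr (by unfold AperyMem; omega)
      have h1 := hn.2.2 _ hx _ hx (by omega) (by omega)
      have h2 := key n hn
      unfold AperyMem at h2
      omega
    · refine ⟨5 * m + 2, 10 * m + 1, 10 * m + 3, fun n hn => ?_⟩
      have hx := (h (5 * m + 2)).mpr (by unfold AperyMem; omega)
      have h1 := hn.2.2 _ hx _ hx (by omega) (by omega)
      have h2 := key n hn
      unfold AperyMem at h2
      omega
    · refine ⟨5 * m + 3, 10 * m + 4, 10 * m + 7, fun n hn => ?_⟩
      have hx := (h (5 * m + 3)).mpr (by unfold AperyMem; omega)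
      have h1 := hn.2.2 _ hx _ hx (by omega) (by omega)
      have h2 := key n hn
      unfold AperyMem at h2
      omega
  have hsub : minimalGenerators H ⊆ (({5, x, y, z} : Finset ℕ) : Set ℕ) := fun n hn => by
    simpa using hx n hn
  calc (minimalGenerators H).ncard ≤ (({5, x, y, z} : Finset ℕ) : Set ℕ).ncard :=
        Set.ncard_le_ncard hsub (Finset.finite_toSet _)
    _ = ({5, x, y, z} : Finset ℕ).card := Set.ncard_coe_finset _
    _ ≤ 4 := Finset.card_le_four
    _ < 5 := by omega

/-- The canonical exponents contain `0, 1, b` and their translates by multiples of 5, and the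
pairwise sums of `0, 1, b` meet every class mod 5. The witnesses are the summand `d ∈ {0, 1, b}` for
each class of `n`. -/
theorem FarFlungShape.exists_add_eq (hs : FarFlungShape m w₁ w₂ w₃ w₄ F)
    (h : ∀ n, n ∈ H ↔ AperyMem w₁ w₂ w₃ w₄ n) (n : ℤ) (hn : 0 ≤ n) :
    ∃ a ∈ canonicalSet H F, ∃ b ∈ canonicalSet H F, a + b = n := by
  have hmem := exists_mem_iff_aperyMem h
  suffices ∃ d : ℤ, ¬(0 ≤ F - d ∧ AperyMem w₁ w₂ w₃ w₄ (F - d).toNat) ∧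
      ¬(0 ≤ F - (n - d) ∧ AperyMem w₁ w₂ w₃ w₄ (F - (n - d)).toNat) by
    obtain ⟨d, h1, h2⟩ := this
    exact ⟨d, fun hd => h1 ((hmem _).mp hd), n - d, fun hd => h2 ((hmem _).mp hd), by omega⟩
  unfold AperyMem
  have hcase : n % 5 = 0 ∨ n % 5 = 1 ∨ n % 5 = 2 ∨ n % 5 = 3 ∨ n % 5 = 4 := by omega
  rcases hs with ⟨rfl, rfl, rfl, rfl, rfl⟩ | ⟨rfl, rfl, rfl, rfl, rfl⟩ |
      ⟨rfl, rfl, rfl, rfl, rfl⟩ | ⟨rfl, rfl, rfl, rfl, rfl⟩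
  · rcases hcase with hi | hi | hi | hi | hi
    exacts [⟨0, by omega⟩, ⟨1, by omega⟩, ⟨1, by omega⟩, ⟨2, by omega⟩, ⟨2, by omega⟩]
  · rcases hcase with hi | hi | hi | hi | hi
    exacts [⟨0, by omega⟩, ⟨1, by omega⟩, ⟨1, by omega⟩, ⟨2, by omega⟩, ⟨2, by omega⟩]
  · rcases hcase with hi | hi | hi | hi | hi
    exacts [⟨0, by omega⟩, ⟨1, by omega⟩, ⟨1, by omega⟩, ⟨3, by omega⟩, ⟨3, by omega⟩]
  · rcases hcase with hi | hi | hi | hi | hi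
    exacts [⟨0, by omega⟩, ⟨1, by omega⟩, ⟨1, by omega⟩, ⟨3, by omega⟩, ⟨3, by omega⟩]

end NumericalSemigroup

/-! ### Classification from the covering condition. -/

section NumericalSemigroup

variable {H : AddSubmonoid ℕ} {e : ℕ} {F : ℤ}

theorem exists_mem_add {a b : ℤ} (ha : ∃ h ∈ H, (h : ℤ) = a) (hb : ∃ h ∈ H, (h : ℤ) = b) :
    ∃ h ∈ H, (h : ℤ) = a + b := by
  obtain ⟨h, hh, rfl⟩ := ha
  obtain ⟨k, hk, rfl⟩ := hb
  exact ⟨h + k, H.add_mem hh hk, by push_cast; rfl⟩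

theorem exists_mem_mul (he : e ∈ H) {k : ℤ} (hk : 0 ≤ k) : ∃ h ∈ H, (h : ℤ) = e * k := by
  refine ⟨k.toNat • e, H.nsmul_mem he _, ?_⟩
  rw [smul_eq_mul, Nat.cast_mul, Int.toNat_of_nonneg hk, mul_comm]

/-- The greatest gap in `n + H` is pseudo-Frobenius. -/
theorem exists_pseudoFrobenius_add (hF : ∀ n, F < n → ∃ h ∈ H, (h : ℤ) = n) {n : ℤ}
    (hn : ¬∃ h ∈ H, (h : ℤ) = n) : ∃ f ∈ pseudoFrobenius H, ∃ h ∈ H, n + (h : ℤ) = f := by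
  obtain ⟨f, ⟨hf, h, hh, hnf⟩, hmax⟩ := Int.exists_greatest_of_bdd
    (P := fun z => (¬∃ h ∈ H, (h : ℤ) = z) ∧ ∃ h ∈ H, n + (h : ℤ) = z)
    ⟨F, fun z hz => not_lt.mp fun hlt => hz.1 (hF z hlt)⟩
    ⟨n, hn, 0, H.zero_mem, by simp⟩
  refine ⟨f, ⟨fun k hk hk0 => ?_, hf⟩, h, hh, hnf⟩
  by_contra hfk
  have := hmax (f + k) ⟨hfk, h + k, H.add_mem hh hk, by push_cast; omega⟩
  omega

/-- Each canonical exponent is `(F - f) + h` with `f` pseudo-Frobenius, `F - f ≥ 0` and `h ∈ H`.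
When two of them sum to less than `e`, both elements `h` must be zero. -/
theorem exists_pseudoFrobenius_sub_add_sub (hF : ∀ n, F < n → ∃ h ∈ H, (h : ℤ) = n)
    (he : IsLeast {h ∈ H | h ≠ 0} e)
    (hcov : ∀ n : ℤ, 0 ≤ n → ∃ a ∈ canonicalSet H F, ∃ b ∈ canonicalSet H F, a + b = n)
    {i : ℤ} (hi : 0 ≤ i) (hie : i < e) :
    ∃ f ∈ pseudoFrobenius H, ∃ g ∈ pseudoFrobenius H, (F - f) + (F - g) = i := by
  obtain ⟨a, ha, b, hb, hab⟩ := hcov i hi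
  obtain ⟨f, hf, h, hh, hhf⟩ := exists_pseudoFrobenius_add hF ha
  obtain ⟨g, hg, k, hk, hkg⟩ := exists_pseudoFrobenius_add hF hb
  have hfF : f ≤ F := not_lt.mp fun hlt => hf.2 (hF f hlt)
  have hgF : g ≤ F := not_lt.mp fun hlt => hg.2 (hF g hlt)
  have hh0 : h = 0 := by
    by_contra h0
    have := he.2 ⟨hh, h0⟩
    omega
  have hk0 : k = 0 := by
    by_contra h0
    have := he.2 ⟨hk, h0⟩
    omega
  exact ⟨f, hf, g, hg, by omega⟩

theorem exists_mem_add_mul_iff (he : e ∈ H) (he0 : e ≠ 0) {f : ℤ} (hf : f ∈ pseudoFrobenius H)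
    (k : ℤ) : (∃ h ∈ H, (h : ℤ) = f + e * k) ↔ 0 < k := by
  constructor
  · intro h
    by_contra hk
    refine hf.2 ?_
    have := exists_mem_add h (exists_mem_mul he (k := -k) (by omega))
    rwa [show f + e * k + e * -k = f by ring] at this
  · intro hk
    have := exists_mem_add (hf.1 e he he0) (exists_mem_mul he (k := k - 1) (by omega))
    rwa [show f + e + e * (k - 1) = f + e * k by ring] at this

/-- Otherwise the larger of the two would be the smaller plus a positive multiple of `e`, hence in
`H`. -/
theorem not_dvd_sub_of_lt (he : e ∈ H) (he0 : e ≠ 0) {f g : ℤ} (hf : f ∈ pseudoFrobenius H)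
    (hg : g ∈ pseudoFrobenius H) (hfg : f ≠ g) : ¬(e : ℤ) ∣ g - f := by
  rintro ⟨k, hk⟩
  have hg' : g = f + e * k := by omega
  have hf' : f = g + e * -k := by rw [hg']; ring
  have h1 : ¬0 < k := fun h => hg.2 (hg' ▸ (exists_mem_add_mul_iff he he0 hf k).mpr h)
  have h2 : ¬0 < -k := fun h => hf.2 (by
    have := (exists_mem_add_mul_iff he he0 hg (-k)).mpr h
    rwa [← hf'] at this)
  have h3 : k = 0 := by omega
  subst h3
  simp at hg'
  exact hfg hg'.symm

/-- Nonnegative multiples of `e` lie in `H`, so such an `f` would be negative. Then `F - f > F` is a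
nonzero element of `H`, and adding it to `f` would put `F` in `H`. -/
theorem not_dvd_of_mem_pseudoFrobenius (hF : ∀ n, F < n → ∃ h ∈ H, (h : ℤ) = n)
    (hF' : ¬∃ h ∈ H, (h : ℤ) = F) (he : IsLeast {h ∈ H | h ≠ 0} e) (he1 : 1 < e) {f : ℤ}
    (hf : f ∈ pseudoFrobenius H) : ¬(e : ℤ) ∣ f := by
  rintro ⟨k, hk⟩
  have hF1 : -1 ≤ F := by
    by_contra hlt
    obtain ⟨h, -, hh⟩ := hF (-1) (by omega)
    omega
  have hk0 : k < 0 := by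
    by_contra h
    exact hf.2 (hk ▸ exists_mem_mul he.1.1 (by omega))
  obtain ⟨h, hh, hhF⟩ := hF (F - f) (by
    have : 0 < (e : ℤ) * -k := by apply mul_pos <;> omega
    have : (e : ℤ) * -k = -f := by rw [hk]; ring
    omega)
  have hle : (e : ℤ) * 1 ≤ e * -k := by
    apply mul_le_mul_of_nonneg_left <;> omega
  have : (e : ℤ) * -k = -f := by rw [hk]; ring
  have := hf.1 h hh (by omega)
  rw [show f + (h : ℤ) = F by omega] at this
  exact hF' this

theorem frobenius_mem_pseudoFrobenius (hF : ∀ n, F < n → ∃ h ∈ H, (h : ℤ) = n)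
    (hF' : ¬∃ h ∈ H, (h : ℤ) = F) : F ∈ pseudoFrobenius H :=
  ⟨fun k _ hk0 => hF _ (by omega), hF'⟩

theorem exists_pseudoFrobenius_eq (hF : ∀ n, F < n → ∃ h ∈ H, (h : ℤ) = n)
    (hF' : ¬∃ h ∈ H, (h : ℤ) = F) (h3 : (pseudoFrobenius H).ncard = 3) :
    ∃ a b : ℤ, 0 < a ∧ a < b ∧ ∀ n, n ∈ pseudoFrobenius H ↔ n = F ∨ n = F - a ∨ n = F - b := by
  obtain ⟨x, y, z, hxy, hxz, hyz, heq⟩ := Set.ncard_eq_three.mp h3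
  have hle : ∀ f ∈ pseudoFrobenius H, f ≤ F := fun f hf => not_lt.mp fun hlt => hf.2 (hF f hlt)
  have hFm := frobenius_mem_pseudoFrobenius hF hF'
  rw [heq] at hle hFm ⊢
  have hx := hle x (by simp)
  have hy := hle y (by simp)
  have hz := hle z (by simp)
  simp only [Set.mem_insert_iff, Set.mem_singleton_iff] at hFm ⊢
  rcases hFm with rfl | rfl | rfl
  · rcases lt_or_gt_of_ne hyz with h | h
    · exact ⟨F - z, F - y, by omega, by omega, fun n => by omega⟩
    · exact ⟨F - y, F - z, by omega, by omega, fun n => by omega⟩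
  · rcases lt_or_gt_of_ne hxz with h | h
    · exact ⟨F - z, F - x, by omega, by omega, fun n => by omega⟩
    · exact ⟨F - x, F - z, by omega, by omega, fun n => by omega⟩
  · rcases lt_or_gt_of_ne hxy with h | h
    · exact ⟨F - y, F - x, by omega, by omega, fun n => by omega⟩
    · exact ⟨F - x, F - y, by omega, by omega, fun n => by omega⟩

/-- The sums `0, a, b, 2a, a + b, 2b` must cover `0, ..., e - 1`. Covering `1` forces `a = 1`. Three
distinct nonzero classes mod `e` force `e ≥ 4`, and then covering `3` forces `b ∈ {2, 3}`. In
neither case is `5` a sum, so `e ≤ 5`. -/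
theorem exists_pseudoFrobenius_eq_of_cover (hF : ∀ n, F < n → ∃ h ∈ H, (h : ℤ) = n)
    (hF' : ¬∃ h ∈ H, (h : ℤ) = F) (he : IsLeast {h ∈ H | h ≠ 0} e)
    (h3 : (pseudoFrobenius H).ncard = 3)
    (hcov : ∀ n : ℤ, 0 ≤ n → ∃ a ∈ canonicalSet H F, ∃ b ∈ canonicalSet H F, a + b = n) :
    (e = 4 ∨ e = 5) ∧ ∃ b : ℤ, (b = 2 ∨ b = 3) ∧
      ∀ n, n ∈ pseudoFrobenius H ↔ n = F ∨ n = F - 1 ∨ n = F - b := by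
  obtain ⟨a, b, ha, hab, hPF⟩ := exists_pseudoFrobenius_eq hF hF' h3
  have hFm : F ∈ pseudoFrobenius H := by rw [hPF]; omega
  have ham : F - a ∈ pseudoFrobenius H := by rw [hPF]; omega
  have hbm : F - b ∈ pseudoFrobenius H := by rw [hPF]; omega
  have hi : ∀ i : ℤ, 0 ≤ i → i < e →
      i = 0 ∨ i = a ∨ i = b ∨ i = 2 * a ∨ i = a + b ∨ i = 2 * b := fun i hi hie => by
    obtain ⟨f, hf, g, hg, hfg⟩ := exists_pseudoFrobenius_sub_add_sub hF he hcov hi hie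
    rw [hPF] at hf hg
    omega
  have d1 := not_dvd_sub_of_lt he.1.1 he.1.2 ham hFm (by omega)
  have d2 := not_dvd_sub_of_lt he.1.1 he.1.2 hbm hFm (by omega)
  have d3 := not_dvd_sub_of_lt he.1.1 he.1.2 hbm ham (by omega)
  have h0 := he.1.2
  have e3 : 3 ≤ e := by
    by_contra hlt
    obtain rfl | rfl : e = 1 ∨ e = 2 := by omega
    all_goals push_cast at d1 d2 d3; omega
  have i1 := hi 1 (by omega) (by omega)
  have ha1 : a = 1 := by omega
  subst ha1
  have d4 := not_dvd_of_mem_pseudoFrobenius hF hF' he (by omega) hFm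
  have d5 := not_dvd_of_mem_pseudoFrobenius hF hF' he (by omega) ham
  have d6 := not_dvd_of_mem_pseudoFrobenius hF hF' he (by omega) hbm
  have e4 : e ≠ 3 := by
    rintro rfl
    push_cast at d1 d2 d3 d4 d5 d6
    omega
  have i3 := hi 3 (by omega) (by omega)
  have e5 : e < 6 := by
    by_contra hlt
    have i5 := hi 5 (by omega) (by omega)
    omega
  exact ⟨by omega, b, by omega, hPF⟩

/-- The pseudo-Frobenius numbers fill all three nonzero classes mod 4, so the nonzero Apéry elements
are the `f + 4`. Each is indecomposable: from `f + 4 = p + q`, with `p` either a multiple of 4 or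
`f' + 4k` with `k ≥ 1`, one would get `f ∈ H`. -/
theorem ncard_minimalGenerators_eq_four (hF : ∀ n, F < n → ∃ h ∈ H, (h : ℤ) = n)
    (hF' : ¬∃ h ∈ H, (h : ℤ) = F) (he : IsLeast {h ∈ H | h ≠ 0} 4) {b : ℤ} (hb : b = 2 ∨ b = 3)
    (hPF : ∀ n, n ∈ pseudoFrobenius H ↔ n = F ∨ n = F - 1 ∨ n = F - b) :
    (minimalGenerators H).ncard = 4 := by
  have hFm : F ∈ pseudoFrobenius H := by rw [hPF]; omega
  have ham : F - 1 ∈ pseudoFrobenius H := by rw [hPF]; omega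
  have hbm : F - b ∈ pseudoFrobenius H := by rw [hPF]; omega
  have d1 := not_dvd_sub_of_lt he.1.1 he.1.2 hbm hFm (by omega)
  have d2 := not_dvd_sub_of_lt he.1.1 he.1.2 hbm ham (by omega)
  have d4 := not_dvd_of_mem_pseudoFrobenius hF hF' he (by omega) hFm
  have d5 := not_dvd_of_mem_pseudoFrobenius hF hF' he (by omega) ham
  have d6 := not_dvd_of_mem_pseudoFrobenius hF hF' he (by omega) hbm
  push_cast at d1 d2 d4 d5 d6
  have hclass : ∀ n : ℤ, ¬(4 : ℤ) ∣ n → ∃ f ∈ pseudoFrobenius H, ∃ k, n = f + 4 * k := by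
    intro n hn
    obtain h | h | h : (4 : ℤ) ∣ n - F ∨ (4 : ℤ) ∣ n - (F - 1) ∨ (4 : ℤ) ∣ n - (F - b) := by omega
    · exact ⟨F, hFm, (n - F) / 4, by omega⟩
    · exact ⟨F - 1, ham, (n - (F - 1)) / 4, by omega⟩
    · exact ⟨F - b, hbm, (n - (F - b)) / 4, by omega⟩
  have hiff := fun {f : ℤ} (hf : f ∈ pseudoFrobenius H) (k : ℤ) =>
    exists_mem_add_mul_iff he.1.1 he.1.2 hf k
  have hmul := fun {k : ℤ} (hk : 0 ≤ k) => exists_mem_mul he.1.1 hk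
  push_cast at hiff hmul
  have hnat : ∀ {n : ℕ}, (∃ h ∈ H, (h : ℤ) = n) → n ∈ H := fun {n} ⟨h, hh, hhn⟩ => by
    rwa [Nat.cast_inj.mp hhn] at hh
  have hnd : ∀ {f : ℤ}, f ∈ pseudoFrobenius H → ¬(4 : ℤ) ∣ f := fun {f} hf => by
    rw [hPF] at hf
    omega
  have hgen : ∀ n : ℕ, n ∈ minimalGenerators H ↔ n = 4 ∨ (n : ℤ) - 4 ∈ pseudoFrobenius H := by
    intro n
    constructor
    · rintro ⟨hn, hn0, hne⟩
      by_contra! hcon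
      have hn4 := he.2 ⟨hn, hn0⟩
      have hsub : n - 4 ∉ H := fun h =>
        hne 4 he.1.1 (n - 4) h (by omega) (by omega) (by omega)
      by_cases hdvd : (4 : ℤ) ∣ n
      · obtain ⟨k, hk⟩ := hdvd
        apply hsub
        apply hnat
        have := hmul (k := k - 1) (by omega)
        rwa [show (4 : ℤ) * (k - 1) = ((n - 4 : ℕ) : ℤ) by omega] at this
      · obtain ⟨f, hf, k, hk⟩ := hclass n hdvd
        have hk0 : 0 < k := (hiff hf k).mp ⟨n, hn, hk⟩
        have hk1 : k ≠ 1 := by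
          rintro rfl
          apply hcon.2
          rwa [show (n : ℤ) - 4 = f by omega]
        apply hsub
        apply hnat
        have := (hiff hf (k - 1)).mpr (by omega)
        rwa [show f + (4 : ℤ) * (k - 1) = ((n - 4 : ℕ) : ℤ) by omega] at this
    · rintro (rfl | hn)
      · refine ⟨he.1.1, he.1.2, fun p hp q hq hp0 hq0 hpq => ?_⟩
        have := he.2 ⟨hp, hp0⟩
        have := he.2 ⟨hq, hq0⟩
        omega
      · have hnH : n ∈ H := hnat (by simpa using hn.1 4 he.1.1 he.1.2)
        refine ⟨hnH, ?_, fun p hp q hq hp0 hq0 hpq => ?_⟩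
        · rintro rfl
          exact hnd hn (by norm_num)
        · by_cases hdvd : (4 : ℤ) ∣ p
          · obtain ⟨k, hk⟩ := hdvd
            refine hn.2 ?_
            have := exists_mem_add ⟨q, hq, rfl⟩ (hmul (k := k - 1) (by omega))
            rwa [show (q : ℤ) + 4 * (k - 1) = n - 4 by omega] at this
          · obtain ⟨f, hf, k, hk⟩ := hclass p hdvd
            have hk0 : 0 < k := (hiff hf k).mp ⟨p, hp, hk⟩
            refine hn.2 ?_
            have := exists_mem_add (hf.1 q hq hq0) (hmul (k := k - 1) (by omega))
            rwa [show f + (q : ℤ) + 4 * (k - 1) = n - 4 by omega] at this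
  have hpos : ∀ {f : ℤ}, f ∈ pseudoFrobenius H → 0 ≤ f + 4 := fun {f} hf => by
    obtain ⟨h, -, hh⟩ := hf.1 4 he.1.1 he.1.2
    push_cast at hh
    omega
  have p1 := hpos hFm
  have p2 := hpos ham
  have p3 := hpos hbm
  have heq : minimalGenerators H = (({4, (F + 4).toNat, (F - 1 + 4).toNat, (F - b + 4).toNat} :
      Finset ℕ) : Set ℕ) := by
    ext n
    rw [hgen, hPF]
    simp only [Finset.coe_insert, Finset.coe_singleton, Set.mem_insert_iff,
      Set.mem_singleton_iff]
    omega
  rw [heq, Set.ncard_coe_finset, Finset.card_insert_of_notMem, Finset.card_insert_of_notMem,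
    Finset.card_pair]
  · omega
  · simp only [Finset.mem_insert, Finset.mem_singleton]
    omega
  · simp only [Finset.mem_insert, Finset.mem_singleton]
    omega

theorem exists_farFlungShape_of_multiplicity_five (hF : ∀ n, F < n → ∃ h ∈ H, (h : ℤ) = n)
    (hF' : ¬∃ h ∈ H, (h : ℤ) = F) (he : IsLeast {h ∈ H | h ≠ 0} 5) {b : ℤ} (hb : b = 2 ∨ b = 3)
    (hPF : ∀ n, n ∈ pseudoFrobenius H ↔ n = F ∨ n = F - 1 ∨ n = F - b) :
    ∃ (m w₁ w₂ w₃ w₄ : ℕ) (F : ℤ), 1 ≤ m ∧ FarFlungShape m w₁ w₂ w₃ w₄ F ∧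
      ∀ n, n ∈ H ↔ AperyMem w₁ w₂ w₃ w₄ n := by
  have hFm : F ∈ pseudoFrobenius H := by rw [hPF]; omega
  have ham : F - 1 ∈ pseudoFrobenius H := by rw [hPF]; omega
  have hbm : F - b ∈ pseudoFrobenius H := by rw [hPF]; omega
  have d4 := not_dvd_of_mem_pseudoFrobenius hF hF' he (by omega) hFm
  have d5 := not_dvd_of_mem_pseudoFrobenius hF hF' he (by omega) ham
  have d6 := not_dvd_of_mem_pseudoFrobenius hF hF' he (by omega) hbm
  push_cast at d4 d5 d6
  -- None of `F, F - 1, F - b` is divisible by 5, which leaves two residues of `F` for each `b`; `r`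
  -- is the nonzero class mod 5 that the three numbers miss.
  obtain ⟨r, hr⟩ : ∃ r : ℤ, (b = 2 ∧ F % 5 = 3 ∧ r = 4) ∨ (b = 2 ∧ F % 5 = 4 ∧ r = 1) ∨
      (b = 3 ∧ F % 5 = 4 ∧ r = 2) ∨ (b = 3 ∧ F % 5 = 2 ∧ r = 3) := by
    have : (b = 2 ∧ F % 5 = 3) ∨ (b = 2 ∧ F % 5 = 4) ∨ (b = 3 ∧ F % 5 = 4) ∨
      (b = 3 ∧ F % 5 = 2) := by omega
    rcases this with h | h | h | h
    exacts [⟨4, by omega⟩, ⟨1, by omega⟩, ⟨2, by omega⟩, ⟨3, by omega⟩]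
  have hclass : ∀ n : ℤ, ¬(5 : ℤ) ∣ n → n % 5 ≠ r →
      ∃ f ∈ pseudoFrobenius H, ∃ k, n = f + 5 * k := by
    intro n hn hnr
    obtain h | h | h : (5 : ℤ) ∣ n - F ∨ (5 : ℤ) ∣ n - (F - 1) ∨ (5 : ℤ) ∣ n - (F - b) := by omega
    · exact ⟨F, hFm, (n - F) / 5, by omega⟩
    · exact ⟨F - 1, ham, (n - (F - 1)) / 5, by omega⟩
    · exact ⟨F - b, hbm, (n - (F - b)) / 5, by omega⟩
  have hiff := fun {f : ℤ} (hf : f ∈ pseudoFrobenius H) (k : ℤ) =>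
    exists_mem_add_mul_iff he.1.1 he.1.2 hf k
  have hmul := fun {k : ℤ} (hk : 0 ≤ k) => exists_mem_mul he.1.1 hk
  push_cast at hiff hmul
  obtain ⟨x, ⟨hxH, hxr⟩, hxmin⟩ : ∃ x, IsLeast {n | n ∈ H ∧ (n : ℤ) % 5 = r} x := by
    obtain ⟨h, hh, hhn⟩ := hF (F + 1 + (r - (F + 1)) % 5) (by omega)
    exact ⟨_, Nat.sInf_mem ⟨h, hh, by omega⟩, fun n hn => Nat.sInf_le hn⟩
  have hx5 := he.2 ⟨hxH, fun h => by subst h; omega⟩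
  have hxadd : ∀ k : ℤ, 0 ≤ k → ∃ h ∈ H, (h : ℤ) = x + 5 * k := fun k hk =>
    exists_mem_add ⟨x, hxH, rfl⟩ (hmul hk)
  -- The gap `x - 5` is in class `r`, so it is not pseudo-Frobenius and some nonzero `h ∈ H` carries
  -- it to another gap. Such an `h` can only be `x`: any other class, or a larger element of class
  -- `r`, would land in `H`. So `2x ∈ H` while `2x - 5` is a gap, and since `2r` is neither `0` nor
  -- `r` mod 5, this gap is pseudo-Frobenius.
  have hx2 : ∃ f ∈ pseudoFrobenius H, (x : ℤ) + x = f + 5 := by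
    have hxsub : ¬∃ h ∈ H, (h : ℤ) = x - 5 := by
      rintro ⟨h, hh, hhx⟩
      have := hxmin ⟨hh, by omega⟩
      omega
    have hxPF : (x : ℤ) - 5 ∉ pseudoFrobenius H := by
      rw [hPF]
      omega
    have hsoc : ∃ h ∈ H, h ≠ 0 ∧ ¬∃ k ∈ H, (k : ℤ) = x - 5 + h := by
      by_contra! hcon
      refine hxPF ⟨fun h hh hh0 => ?_, hxsub⟩
      by_contra hk
      obtain ⟨k, hk1, hk2⟩ := hcon h hh hh0
      exact hk ⟨k, hk1, hk2⟩
    obtain ⟨h, hh, hh0, hnot⟩ := hsoc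
    have hh5 := he.2 ⟨hh, hh0⟩
    have h1 : ¬(5 : ℤ) ∣ h := by
      rintro ⟨k, hk⟩
      apply hnot
      have := hxadd (k - 1) (by omega)
      rwa [show (x : ℤ) + 5 * (k - 1) = x - 5 + h by omega] at this
    have h2 : (h : ℤ) % 5 = r := by
      by_contra hne
      obtain ⟨f, hf, k, hk⟩ := hclass h h1 hne
      have hk0 : 0 < k := (hiff hf k).mp ⟨h, hh, hk⟩
      apply hnot
      have := exists_mem_add (hf.1 x hxH (by omega)) (hmul (k := k - 1) (by omega))
      rwa [show f + (x : ℤ) + 5 * (k - 1) = x - 5 + h by omega] at this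
    have h3 : h = x := by
      have hle := hxmin ⟨hh, h2⟩
      by_contra hne
      apply hnot
      have := exists_mem_add ⟨x, hxH, rfl⟩ (hxadd ((h - x) / 5 - 1) (by omega))
      rwa [show (x : ℤ) + (x + 5 * (((h : ℤ) - x) / 5 - 1)) = x - 5 + h by omega] at this
    subst h3
    obtain ⟨f, hf, k, hk⟩ := hclass (h + h) (by omega) (by omega)
    have hk0 : 0 < k := (hiff hf k).mp ⟨h + h, H.add_mem hh hh, by push_cast; exact hk⟩
    have hk1 : ¬0 < k - 1 := fun hlt => by
      apply hnot
      have := (hiff hf (k - 1)).mpr hlt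
      rwa [show f + 5 * (k - 1) = (h : ℤ) - 5 + h by omega] at this
    exact ⟨f, hf, by omega⟩
  obtain ⟨f, hf, hxf⟩ := hx2
  rw [hPF] at hf
  have hmem : ∀ n : ℕ, n ∈ H ↔ (n : ℤ) % 5 = 0 ∨ ((n : ℤ) % 5 = r ∧ x ≤ n) ∨
      ((n - F) % 5 = 0 ∧ F < n) ∨ ((n - (F - 1)) % 5 = 0 ∧ F - 1 < n) ∨
      ((n - (F - b)) % 5 = 0 ∧ F - b < n) := by
    intro n
    have hnat : ∀ n : ℕ, n ∈ H ↔ ∃ h ∈ H, (h : ℤ) = n := fun n =>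
      ⟨fun h => ⟨n, h, rfl⟩, fun ⟨h, hh, hhn⟩ => by rwa [Nat.cast_inj.mp hhn] at hh⟩
    have hcl : ∀ f ∈ pseudoFrobenius H, (5 : ℤ) ∣ n - f → (n ∈ H ↔ f < n) := by
      rintro f hf ⟨k, hk⟩
      rw [hnat, show (n : ℤ) = f + 5 * k by omega, hiff hf]
      omega
    by_cases h0 : (n : ℤ) % 5 = 0
    · refine iff_of_true ?_ (Or.inl h0)
      rw [hnat, show (n : ℤ) = 5 * (n / 5) by omega]
      exact hmul (by omega)
    by_cases h1 : (n : ℤ) % 5 = r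
    · have : n ∈ H ↔ x ≤ n := by
        refine ⟨fun h => hxmin ⟨h, h1⟩, fun h => ?_⟩
        rw [hnat, show (n : ℤ) = x + 5 * ((n - x) / 5) by omega]
        exact hxadd _ (by omega)
      rw [this]
      omega
    obtain h | h | h : (5 : ℤ) ∣ n - F ∨ (5 : ℤ) ∣ n - (F - 1) ∨ (5 : ℤ) ∣ n - (F - b) := by omega
    · rw [hcl F hFm h]
      omega
    · rw [hcl _ ham h]
      omega
    · rw [hcl _ hbm h]
      omega
  -- The class of `2x` mod 5 decides which of `F, F - 1, F - b` equals `2x - 5`, so `F` is a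
  -- function of `x`. Here `m = x / 5 ≥ 1` since `x ≥ 5`.
  rcases hr with ⟨rfl, hr, rfl⟩ | ⟨rfl, hr, rfl⟩ | ⟨rfl, hr, rfl⟩ | ⟨rfl, hr, rfl⟩
  · refine ⟨x / 5, 10 * (x / 5) + 6, 10 * (x / 5) + 7, 10 * (x / 5) + 8, 5 * (x / 5) + 4,
      10 * (x / 5 : ℕ) + 3, by omega, Or.inl ⟨rfl, rfl, rfl, rfl, rfl⟩, fun n => ?_⟩
    rw [hmem]
    unfold AperyMem
    have hFx : F = 10 * (x / 5 : ℕ) + 3 := by omega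
    omega
  · refine ⟨x / 5, 5 * (x / 5) + 1, 10 * (x / 5) + 2, 10 * (x / 5) + 3, 10 * (x / 5) + 4,
      10 * (x / 5 : ℕ) - 1, by omega, Or.inr (Or.inl ⟨rfl, rfl, rfl, rfl, rfl⟩), fun n => ?_⟩
    rw [hmem]
    unfold AperyMem
    have hFx : F = 10 * (x / 5 : ℕ) - 1 := by omega
    omega
  · refine ⟨x / 5, 10 * (x / 5) + 1, 5 * (x / 5) + 2, 10 * (x / 5) + 3, 10 * (x / 5) + 4,
      10 * (x / 5 : ℕ) - 1, by omega, Or.inr (Or.inr (Or.inl ⟨rfl, rfl, rfl, rfl, rfl⟩)),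
      fun n => ?_⟩
    rw [hmem]
    unfold AperyMem
    have hFx : F = 10 * (x / 5 : ℕ) - 1 := by omega
    omega
  · refine ⟨x / 5, 10 * (x / 5) + 6, 10 * (x / 5) + 7, 5 * (x / 5) + 3, 10 * (x / 5) + 4,
      10 * (x / 5 : ℕ) + 2, by omega, Or.inr (Or.inr (Or.inr ⟨rfl, rfl, rfl, rfl, rfl⟩)),
      fun n => ?_⟩
    rw [hmem]
    unfold AperyMem
    have hFx : F = 10 * (x / 5 : ℕ) + 2 := by omega
    omega

theorem exists_farFlungShape (hF : ∀ n, F < n → ∃ h ∈ H, (h : ℤ) = n)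
    (hF' : ¬∃ h ∈ H, (h : ℤ) = F) (he : IsLeast {h ∈ H | h ≠ 0} e)
    (h3 : (pseudoFrobenius H).ncard = 3) (hne : (minimalGenerators H).ncard ≠ e)
    (hcov : ∀ n : ℤ, 0 ≤ n → ∃ a ∈ canonicalSet H F, ∃ b ∈ canonicalSet H F, a + b = n) :
    ∃ (m w₁ w₂ w₃ w₄ : ℕ) (F : ℤ), 1 ≤ m ∧ FarFlungShape m w₁ w₂ w₃ w₄ F ∧
      ∀ n, n ∈ H ↔ AperyMem w₁ w₂ w₃ w₄ n := by
  obtain ⟨rfl | rfl, b, hb, hPF⟩ := exists_pseudoFrobenius_eq_of_cover hF hF' he h3 hcov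
  · exact absurd (ncard_minimalGenerators_eq_four hF hF' he hb hPF) hne
  · exact exists_farFlungShape_of_multiplicity_five hF hF' he hb hPF

end NumericalSemigroup

/-! ### Application to `K[|H|]` and the main theorem. -/

section SemigroupRing

variable (K : Type*) [Field K] (H : AddSubmonoid ℕ)

instance semigroupRing_isSemigroupRing : IsSemigroupRing K H (semigroupRing K H) where
  algebraMap_injective := fun f g h =>
    Subtype.ext (HahnSeries.ofPowerSeries_injective h)
  mem_range_algebraMap_iff := fun f => by
    constructor
    · rintro ⟨r, rfl⟩ n hn
      change HahnSeries.coeff ((r : PowerSeries K) : LaurentSeries K) n ≠ 0 at hn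
      rw [PowerSeries.coeff_coe] at hn
      split_ifs at hn with h0
      · exact absurd rfl hn
      · exact ⟨n.natAbs, r.2 _ hn, by omega⟩
    · intro hf
      refine ⟨⟨PowerSeries.mk fun n => f.coeff n, fun n hn => ?_⟩, ?_⟩
      · rw [PowerSeries.coeff_mk] at hn
        obtain ⟨h, hh, hhn⟩ := hf n hn
        rwa [Nat.cast_inj.mp hhn] at hh
      · ext n
        change HahnSeries.coeff ((PowerSeries.mk fun n : ℕ => f.coeff n : PowerSeries K) :
          LaurentSeries K) n = _
        rw [PowerSeries.coeff_coe]
        split_ifs with h0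
        · by_contra hne
          obtain ⟨h, -, hhn⟩ := hf n (Ne.symm hne)
          omega
        · rw [PowerSeries.coeff_mk, Int.natCast_natAbs, abs_of_nonneg (by omega)]
  isUnit_of_coeff_zero_ne_zero := fun r hr => by
    refine semigroupRing_isUnit K H r ?_
    change HahnSeries.coeff ((r : PowerSeries K) : LaurentSeries K) 0 ≠ 0 at hr
    rwa [PowerSeries.coeff_coe, if_neg (by omega)] at hr

variable {H}

theorem exists_frobenius (hH : ((H : Set ℕ)ᶜ).Finite) :
    ∃ F : ℤ, (∀ n, F < n → ∃ h ∈ H, (h : ℤ) = n) ∧ ¬∃ h ∈ H, (h : ℤ) = F := by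
  obtain ⟨B, hB⟩ := hH.bddAbove
  obtain ⟨F, hF', hF⟩ := Int.exists_greatest_of_bdd (P := fun n => ¬∃ h ∈ H, (h : ℤ) = n)
    ⟨B, fun n hn => by
      by_contra hlt
      refine hn ⟨n.toNat, ?_, by omega⟩
      by_contra hnH
      have : n.toNat ≤ B := hB hnH
      -- Gaps are taken among all integers, so `-1` is always one; when `H` is all of `ℕ` this gives
      -- `F = -1`.
      omega⟩ ⟨-1, by
      rintro ⟨h, -, hh⟩
      omega⟩
  refine ⟨F, fun n hn => ?_, hF'⟩
  by_contra h
  have := hF n h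
  omega

theorem exists_isLeast_ne_zero (hH : ((H : Set ℕ)ᶜ).Finite) :
    ∃ e, IsLeast {h ∈ H | h ≠ 0} e := by
  obtain ⟨F, hF, -⟩ := exists_frobenius hH
  obtain ⟨h, hh, hhF⟩ := hF (|F| + 1) (lt_of_le_of_lt (le_abs_self F) (by omega))
  have h0 : h ≠ 0 := by
    rintro rfl
    have := abs_nonneg F
    omega
  exact ⟨_, Nat.sInf_mem ⟨h, hh, h0⟩, fun n hn => Nat.sInf_le hn⟩

theorem pseudoFrobenius_finite {e : ℕ} {F : ℤ} (hF : ∀ n, F < n → ∃ h ∈ H, (h : ℤ) = n)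
    (he : e ∈ H) (he0 : e ≠ 0) : (pseudoFrobenius H).Finite := by
  refine (Set.finite_Icc (-(e : ℤ)) F).subset fun f hf => ⟨?_, ?_⟩
  · obtain ⟨h, -, hh⟩ := hf.1 e he he0
    omega
  · by_contra hlt
    exact hf.2 (hF f (by omega))

theorem minimalGenerators_finite {e : ℕ} {F : ℤ} (hF : ∀ n, F < n → ∃ h ∈ H, (h : ℤ) = n)
    (he : e ∈ H) (he0 : e ≠ 0) : (minimalGenerators H).Finite := by
  refine (Set.finite_Iic (e + e + F.toNat)).subset fun n hn => ?_
  rw [Set.mem_Iic]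
  by_contra hlt
  obtain ⟨h, hh, hhn⟩ := hF (n - e) (by omega)
  exact hn.2.2 e he h hh he0 (by omega) (by omega)

theorem hasMinimalMultiplicity_iff {e : ℕ} (hH : ((H : Set ℕ)ᶜ).Finite)
    (he : IsLeast {h ∈ H | h ≠ 0} e) :
    HasMinimalMultiplicity (semigroupRing K H) ↔ (minimalGenerators H).ncard = e := by
  obtain ⟨F, hF, -⟩ := exists_frobenius hH
  have hmult : HasMultiplicity (semigroupRing K H) e := hasMultiplicity_of_isLeast K _ hH he
  unfold HasMinimalMultiplicity
  rw [embeddingDim_eq_ncard K _ he.1.1 he.1.2 (minimalGenerators_finite hF he.1.1 he.1.2)]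
  refine ⟨fun h => ?_, fun h => h ▸ hmult⟩
  exact Nat.cast_injective (R := ℝ) (tendsto_nhds_unique h hmult)

end SemigroupRing

theorem mainTheorem8 (K : Type*) [Field K] (H : AddSubmonoid ℕ) (hH : ((H : Set ℕ)ᶜ).Finite) :
    (cohenMacaulayType (semigroupRing K H) = 3 ∧
      ¬ HasMinimalMultiplicity (semigroupRing K H) ∧
      IsFarFlungGorenstein (semigroupRing K H)) ↔
    ∃ m : ℕ, 1 ≤ m ∧
      (H = AddSubmonoid.closure {5, 5 * m + 4, 10 * m + 6, 10 * m + 7} ∨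
       H = AddSubmonoid.closure {5, 5 * m + 1, 10 * m + 3, 10 * m + 4} ∨
       H = AddSubmonoid.closure {5, 5 * m + 2, 10 * m + 1, 10 * m + 3} ∨
       H = AddSubmonoid.closure {5, 5 * m + 3, 10 * m + 4, 10 * m + 7}) := by
  obtain ⟨F, hF, hF'⟩ := exists_frobenius hH
  obtain ⟨e, he⟩ := exists_isLeast_ne_zero hH
  rw [exists_eq_closure_iff, hasMinimalMultiplicity_iff K hH he,
    isFarFlungGorenstein_iff K _ hF hF',
    cohenMacaulayType_eq_ncard K _ hF (pseudoFrobenius_finite hF he.1.1 he.1.2)]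
  constructor
  · rintro ⟨h3, hne, hcov⟩
    exact exists_farFlungShape hF hF' he (by exact_mod_cast h3) hne hcov
  · rintro ⟨m, w₁, w₂, w₃, w₄, F₁, hm, hs, h⟩
    obtain ⟨hF₁, hF₁'⟩ := hs.frobenius hm h
    obtain rfl : F = F₁ := le_antisymm (not_lt.mp fun hlt => hF' (hF₁ F hlt))
      (not_lt.mp fun hlt => hF₁' (hF F₁ hlt))
    obtain rfl : e = 5 := he.unique (hs.isLeast hm h)
    refine ⟨by exact_mod_cast hs.ncard_pseudoFrobenius hm h,
      (hs.ncard_minimalGenerators_lt hm h).ne, hs.exists_add_eq h⟩
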